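/- **Completeness Theorem (2nd version).** Let $S$ be a signature of first-order functional logic and let $T$ be a set of formulas of $S$ that is consistent, i.e. $T\nvdash\bot$. Then $T$ has a model: there is a normal structure $M$ of signature $S$ with $M\models T$. The notions are as follows. *Signature.* $S$ consists of a set of sorts with a distinguished sort $\pi$ (formulas); a subset $V$ of the sorts; for each $s\in V$ a countably infinite set of variables of sort $s$ (disjoint for different $s$, and disjoint from the symbols); and a set of symbols, each with a type $((\vec\beta_1)\alpha_1,\dots,(\vec\beta_m)\alpha_m)\gamma$, where $m\ge 0$, $\gamma,\alpha_i$ are sorts and $\vec\beta_i$ is a finite, possibly empty, sequence of sorts in $V$. Among the symbols are the pairwise distinct logical symbols $\top,\bot$ of type $\pi$; $\neg$ of type $(\pi)\pi$; $\to,\wedge,\vee$ of type $(\pi,\pi)\pi$; $\forall^s,\exists^s$ of type $((s)\pi)\pi$ for $s\in V$; and $=^\alpha$ of type $(\alpha,\alpha)\pi$ for every sort $\alpha$. The symbol $\leftrightarrow$ is $=^\pi$. *Expressions.* A variable of sort $s$ is an expression of sort $s$. If $\mathrm{op}$ has the above type, each $a_i$ is an expression of sort $\alpha_i$ and each $\vec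 v_i$ is a sequence of pairwise distinct variables of sorts $\vec\beta_i$, then $\mathrm{op}((\vec v_1){:}a_1,\dots,(\vec v_m){:}a_m)$ is an expression of sort $\gamma$, in which $\vec v_i$ is bound in $a_i$. Formulas are the expressions of sort $\pi$. $e[\vec x\leftarrow\vec d]$ denotes simultaneous replacement of the free occurrences of $\vec x$ by $\vec d$, without renaming. An expression $d$ is substitutable for $x$ in every variable, and it is substitutable for $x$ in $\mathrm{op}((\vec v_1){:}a_1,\dots)$ iff for each $i$ either $x$ is in $\vec v_i$, or $d$ is substitutable for $x$ in $a_i$ and no free variable of $d$ is in $\vec v_i$. *Calculus.* The logical axioms are: the propositional tautologies; $\forall x\,\varphi\to\varphi[x\leftarrow a]$ and $\varphi[x\leftarrow a]\to\exists x\,\varphi$ for $a$ of the sort of $x$ and substitutable for $x$ in $\varphi$; $\forall x(\psi\to\varphi)\to(\psi\to\forall x\,\varphi)$ and $\forall x(\varphi\to\psi)\to(\exists x\,\varphi\to\psi)$ for $x$ not free in $\psi$; $a=^\alpha a$ for every sort $\alpha$ and every $a$ of sort $\alpha$; and $$\forall \vec z\;\bigl(b_1[\vec x\leftarrow\vec z]=^{\alpha_i}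 b_2[\vec y\leftarrow\vec z]\bigr)\;\to\;\mathrm{op}(\Delta,(\vec x){:}b_1,\Gamma)=^\gamma \mathrm{op}(\Delta,(\vec y){:}b_2,\Gamma)$$ for every symbol $\mathrm{op}$ and argument place $i$, where $\Delta,\Gamma$ are the other arguments (with their binding variables), $b_1,b_2$ have sort $\alpha_i$, $\vec x,\vec y,\vec z$ are sequences of variables of sorts $\vec\beta_i$, and the $\vec z$ are pairwise distinct and occur neither free nor bound in $b_1$ or $b_2$. The rules are detachment (from $\varphi$ and $\varphi\to\psi$ infer $\psi$) and generalization (from $\varphi$ infer $\forall x\,\varphi$). $T\vdash\varphi$ means that $\varphi$ is derivable from the logical axioms and the members of $T$ by these rules. *Normal structure.* $M$ assigns to each sort $\alpha$ a non-empty set $M_\alpha$. Put $M_{\vec\sigma}=\prod_i M_{\sigma_i}$. To each sort $\gamma$ and finite sequence $\vec\sigma$ of sorts in $V$, $M$ assigns a set $M_\gamma^{\vec\sigma}$ of maps $M_{\vec\sigma}\to M_\gamma$ (with $M_\gamma^{\langle\rangle}=M_\gamma$), and to each symbol $\mathrm{op}$ of the above type a map $M(\mathrm{op}):\prod_i M_{\alpha_i}^{\vec\beta_i}\to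 M_\gamma$ (an element of $M_\gamma$ if $m=0$). The sets $M_\gamma^{\vec\sigma}$ contain all constant maps and, for $\gamma=\sigma_j$, the projection to the $j$-th component; if $g\in M_\gamma^{\vec\sigma\vec\varrho}$ and $\vec x\in M_{\vec\sigma}$, then $g(\vec x\,\cdot)\in M_\gamma^{\vec\varrho}$; and if $g_i\in M_{\alpha_i}^{\vec\sigma\vec\beta_i}$ for all $i$, then $\vec y\mapsto M(\mathrm{op})(g_1(\vec y\,\cdot),\dots,g_m(\vec y\,\cdot))$ is in $M_\gamma^{\vec\sigma}$. Moreover $M_\pi=\{M(\bot),M(\top)\}$ has exactly two elements (false and true), the connectives are interpreted by their truth tables, $\forall^s$ and $\exists^s$ by quantification over $M_s$, and $=^\alpha$ by equality on $M_\alpha$. *Satisfaction.* If $\vec u$ is a sequence of variables of sorts $\vec\sigma$ containing all free variables of the expression $e$ of sort $\gamma$, then $e_M(\vec u)\in M_\gamma^{\vec\sigma}$ is defined recursively: a variable is evaluated by the projection to its last position in $\vec u$, and $\mathrm{op}((\vec v_1){:}a_1,\dots,(\vec v_m){:}a_m)_M(\vec u)(\vec x)=M(\mathrm{op})\bigl(\vec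 y\mapsto (a_i)_M(\vec u\vec v_i)(\vec x\vec y)\bigr)_{i}$. $M\models\varphi$ means that $\varphi_M(\vec u)(\vec x)$ is true for all such $\vec u$ and all $\vec x\in M_{\vec\sigma}$; $M\models T$ means $M\models\varphi$ for all $\varphi\in T$. -/

import Mathlib

universe u

namespace FnlLogic

/-! ### Signatures -/

/-- The type `((β₁₁,…)α₁, …, (βₘ₁,…)αₘ)γ` of a symbolic operation: `arity` argument places, the
`i`-th of which takes an expression of sort `argSort i` bound by a sequence of variables of sorts
`binders i` (possibly empty); the result has sort `res`. -/
structure OpType (Srt : Type u) (VSrt : Set Srt) where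
  arity : ℕ
  argSort : Fin arity → Srt
  binders : Fin arity → List VSrt
  res : Srt

/-- A signature of first order functional logic. `Srt` are the sorts, `prop` is the sort of
formulas, `VSrt` are the sorts for which variables and quantifiers are provided, `Var s` are the
variables of sort `s`, and `Op` are the symbolic operations other than the distinguished (logical)
ones, which are added in `Signature.Sym`. -/
structure Signature where
  Srt : Type u
  prop : Srt
  VSrt : Set Srt
  Var : VSrt → Type u
  var_enumerable : ∀ s, Nonempty (Var s ≃ ℕ)
  Op : Type u
  opType : Op → OpType Srt VSrt

namespace Signature

variable (S : Signature.{u})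

/-- All symbolic operations of a signature: the distinguished ones and those in `S.Op`.
Logical equivalence is not listed separately, because it is the same symbol as equality of the
sort `prop`. -/
inductive Sym : Type u
  | verum : Sym
  | falsum : Sym
  | neg : Sym
  | imp : Sym
  | and : Sym
  | or : Sym
  | all (s : S.VSrt) : Sym
  | ex (s : S.VSrt) : Sym
  | eq (α : S.Srt) : Sym
  | op (o : S.Op) : Sym

/-- The signature map on symbolic operations. -/
@[reducible] def sig : S.Sym → OpType S.Srt S.VSrt
  | .verum => ⟨0, fun _ => S.prop, fun _ => [], S.prop⟩
  | .falsum => ⟨0, fun _ => S.prop, fun _ => [], S.prop⟩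
  | .neg => ⟨1, fun _ => S.prop, fun _ => [], S.prop⟩
  | .imp => ⟨2, fun _ => S.prop, fun _ => [], S.prop⟩
  | .and => ⟨2, fun _ => S.prop, fun _ => [], S.prop⟩
  | .or => ⟨2, fun _ => S.prop, fun _ => [], S.prop⟩
  | .all s => ⟨1, fun _ => S.prop, fun _ => [s], S.prop⟩
  | .ex s => ⟨1, fun _ => S.prop, fun _ => [s], S.prop⟩
  | .eq α => ⟨2, fun _ => α, fun _ => [], S.prop⟩
  | .op o => S.opType o

/-- A variable together with its sort. -/
abbrev AnyVar : Type u := Σ s : S.VSrt, S.Var s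

/-- Sequences of variables of the sequence of sorts `σ`. -/
abbrev VarSeq (σ : List S.VSrt) : Type u := List.TProd S.Var σ

end Signature

/-! ### Finite sequences of objects of given sorts -/

section Tuples

variable {ι : Type u} {C : ι → Type u}

/-- Concatenation of sequences. -/
def tappend : {σ ρ : List ι} → List.TProd C σ → List.TProd C ρ → List.TProd C (σ ++ ρ)
  | [], _, _, y => y
  | _ :: _, _, x, y => (x.1, tappend x.2 y)

/-- The `j`-th component of a sequence. -/
def tget : {σ : List ι} → List.TProd C σ → (j : Fin σ.length) → C (σ.get j)
  | _ :: _, x, ⟨0, _⟩ => x.1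
  | _ :: _, x, ⟨j + 1, h⟩ => tget x.2 ⟨j, Nat.lt_of_succ_lt_succ h⟩

/-- The plain list of the components of a sequence, each paired with its sort. -/
def tlist : {σ : List ι} → List.TProd C σ → List (Σ s, C s)
  | [], _ => []
  | s :: _, x => ⟨s, x.1⟩ :: tlist x.2

theorem tlist_tappend : {σ ρ : List ι} → (x : List.TProd C σ) → (y : List.TProd C ρ) →
    tlist (tappend x y) = tlist x ++ tlist y
  | [], _, _, _ => rfl
  | s :: _, _, x, y => by
      have ih := tlist_tappend x.2 y
      simp only [tlist, List.cons_append, ← ih]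
      rfl

end Tuples

/-! ### Expressions -/

/-- `Expr S γ` are the expressions of sort `γ`: variables, and symbolic operations applied to
argument expressions `args i`, each bound by a sequence `vs i` of pairwise distinct variables of the
prescribed sorts (constants are the case of arity `0`). -/
inductive Expr (S : Signature.{u}) : S.Srt → Type u
  | var (x : S.AnyVar) : Expr S x.1
  | app (o : S.Sym)
      (vs : (i : Fin (S.sig o).arity) →
        {v : S.VarSeq ((S.sig o).binders i) // (tlist v).Nodup})
      (args : (i : Fin (S.sig o).arity) → Expr S ((S.sig o).argSort i)) :
      Expr S (S.sig o).res

/-- The formulas are the expressions of sort `prop`. -/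
abbrev Formula (S : Signature.{u}) : Type u := Expr S S.prop

namespace Expr

variable {S : Signature.{u}}

def verum : Formula S := app .verum (fun i => i.elim0) (fun i => i.elim0)

def falsum : Formula S := app .falsum (fun i => i.elim0) (fun i => i.elim0)

def neg (φ : Formula S) : Formula S :=
  app .neg (fun _ => ⟨PUnit.unit, List.nodup_nil⟩) (fun _ => φ)

def imp (φ ψ : Formula S) : Formula S :=
  app .imp (fun _ => ⟨PUnit.unit, List.nodup_nil⟩) ![φ, ψ]

def and (φ ψ : Formula S) : Formula S :=
  app .and (fun _ => ⟨PUnit.unit, List.nodup_nil⟩) ![φ, ψ]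

def or (φ ψ : Formula S) : Formula S :=
  app .or (fun _ => ⟨PUnit.unit, List.nodup_nil⟩) ![φ, ψ]

/-- Equality of expressions of the sort `α`. -/
def eq {α : S.Srt} (a b : Expr S α) : Formula S :=
  app (.eq α) (fun _ => ⟨PUnit.unit, List.nodup_nil⟩) ![a, b]

/-- Logical equivalence is equality of the sort `prop`. -/
abbrev iff (φ ψ : Formula S) : Formula S := eq φ ψ

def all (x : S.AnyVar) (φ : Formula S) : Formula S :=
  app (.all x.1) (fun _ => ⟨(x.2, PUnit.unit), List.nodup_singleton _⟩) (fun _ => φ)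

def ex (x : S.AnyVar) (φ : Formula S) : Formula S :=
  app (.ex x.1) (fun _ => ⟨(x.2, PUnit.unit), List.nodup_singleton _⟩) (fun _ => φ)

/-- `∀ z₁ … ∀ zₗ φ` for a list of variables. -/
def allList : List S.AnyVar → Formula S → Formula S
  | [], φ => φ
  | z :: zs, φ => all z (allList zs φ)

/-- Free variables. -/
def fv : {γ : S.Srt} → Expr S γ → Set S.AnyVar
  | _, var x => {x}
  | _, app _ vs args => ⋃ i, fv (args i) \ {x | x ∈ tlist (vs i).1}

/-- Bound variables. -/
def bv : {γ : S.Srt} → Expr S γ → Set S.AnyVar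
  | _, var _ => ∅
  | _, app _ vs args => ⋃ i, bv (args i) ∪ {x | x ∈ tlist (vs i).1}

/-- Substitutability of the expression `d` for the variable `x` in an expression. -/
def Substitutable {δ : S.Srt} (d : Expr S δ) (x : S.AnyVar) : {γ : S.Srt} → Expr S γ → Prop
  | _, var _ => True
  | _, app _ vs args => ∀ i, x ∈ tlist (vs i).1 ∨
      (Substitutable d x (args i) ∧ ∀ y ∈ fv d, y ∉ tlist (vs i).1)

open Classical in
/-- Simultaneous replacement of the free occurrences of each variable `x` by `θ x`. -/
noncomputable def subst : {γ : S.Srt} → Expr S γ → ((x : S.AnyVar) → Expr S x.1) → Expr S γ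
  | _, var x, θ => θ x
  | _, app o vs args, θ => app o vs fun i =>
      subst (args i) fun x => if x ∈ tlist (vs i).1 then var x else θ x

open Classical in
/-- The replacement of the single variable `x` by `a`. -/
noncomputable def single (x : S.AnyVar) (a : Expr S x.1) : (y : S.AnyVar) → Expr S y.1 :=
  Function.update var x a

open Classical in
/-- The replacement of the variables in a sequence by the expressions in the same positions of a
sequence of the same sorts (the rightmost position counts if a variable is repeated); other
variables are sent to `θ`. -/
noncomputable def seqSubst (θ : (y : S.AnyVar) → Expr S y.1) : {σ : List S.VSrt} →
    S.VarSeq σ → List.TProd (fun s : S.VSrt => Expr S s) σ → (y : S.AnyVar) → Expr S y.1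
  | [], _, _ => θ
  | s :: _, x, d => seqSubst (Function.update θ ⟨s, x.1⟩ d.1) x.2 d.2

/-- A sequence of variables as a sequence of expressions. -/
def varSeq : {σ : List S.VSrt} → S.VarSeq σ → List.TProd (fun s : S.VSrt => Expr S s) σ
  | [], _ => PUnit.unit
  | s :: _, x => (var ⟨s, x.1⟩, varSeq x.2)

/-- `e.rename x z` is `e[x₁,…,xₗ ← z₁,…,zₗ]`. -/
noncomputable def rename {γ : S.Srt} (e : Expr S γ) {σ : List S.VSrt} (x z : S.VarSeq σ) :
    Expr S γ :=
  e.subst (seqSubst var x (varSeq z))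

/-- `u` is a perspective of `e`: every free variable of `e` occurs in the sequence `u`. -/
def Persp {γ : S.Srt} (e : Expr S γ) {σ : List S.VSrt} (u : S.VarSeq σ) : Prop :=
  ∀ x ∈ fv e, x ∈ tlist u

theorem Persp.arg {o : S.Sym}
    {vs : (i : Fin (S.sig o).arity) → {v : S.VarSeq ((S.sig o).binders i) // (tlist v).Nodup}}
    {args : (i : Fin (S.sig o).arity) → Expr S ((S.sig o).argSort i)}
    {σ : List S.VSrt} {u : S.VarSeq σ} (h : (app o vs args).Persp u)
    (i : Fin (S.sig o).arity) : (args i).Persp (tappend u (vs i).1) := by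
  intro x hx
  rw [tlist_tappend, List.mem_append]
  by_cases hv : x ∈ tlist (vs i).1
  · exact Or.inr hv
  · exact Or.inl (h x (by rw [fv]; exact Set.mem_iUnion.2 ⟨i, hx, hv⟩))

end Expr

/-! ### The calculus -/

section Calculus

variable {S : Signature.{u}}

/-- A truth valuation of formulas that respects the propositional connectives. -/
structure IsValuation (v : Formula S → Prop) : Prop where
  verum : v Expr.verum
  falsum : ¬ v Expr.falsum
  neg : ∀ φ, v φ.neg ↔ ¬ v φ
  imp : ∀ φ ψ, v (φ.imp ψ) ↔ (v φ → v ψ)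
  and : ∀ φ ψ, v (φ.and ψ) ↔ (v φ ∧ v ψ)
  or : ∀ φ ψ, v (φ.or ψ) ↔ (v φ ∨ v ψ)
  iff : ∀ φ ψ, v (φ.iff ψ) ↔ (v φ ↔ v ψ)

/-- Propositional tautologies. -/
def Tautology (φ : Formula S) : Prop := ∀ v : Formula S → Prop, IsValuation v → v φ

/-- The logical axioms. In `eq_congr` the two compound expressions differ at most in their `i`-th
argument (with its binding variables), and the variables `z` are new and pairwise distinct. -/
inductive LogicalAxiom : Formula S → Prop
  | taut (φ : Formula S) : Tautology φ → LogicalAxiom φ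
  | all_inst (x : S.AnyVar) (φ : Formula S) (a : Expr S x.1) : a.Substitutable x φ →
      LogicalAxiom ((Expr.all x φ).imp (φ.subst (Expr.single x a)))
  | ex_intro (x : S.AnyVar) (φ : Formula S) (a : Expr S x.1) : a.Substitutable x φ →
      LogicalAxiom ((φ.subst (Expr.single x a)).imp (Expr.ex x φ))
  | all_imp (x : S.AnyVar) (φ ψ : Formula S) : x ∉ ψ.fv →
      LogicalAxiom ((Expr.all x (ψ.imp φ)).imp (ψ.imp (Expr.all x φ)))
  | ex_imp (x : S.AnyVar) (φ ψ : Formula S) : x ∉ ψ.fv →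
      LogicalAxiom ((Expr.all x (φ.imp ψ)).imp ((Expr.ex x φ).imp ψ))
  | eq_refl {α : S.Srt} (a : Expr S α) : LogicalAxiom (a.eq a)
  | eq_congr (o : S.Sym) (i : Fin (S.sig o).arity)
      (vs ws : (j : Fin (S.sig o).arity) →
        {v : S.VarSeq ((S.sig o).binders j) // (tlist v).Nodup})
      (a b : (j : Fin (S.sig o).arity) → Expr S ((S.sig o).argSort j))
      (z : S.VarSeq ((S.sig o).binders i)) :
      (∀ j, j ≠ i → vs j = ws j ∧ a j = b j) →
      (tlist z).Nodup →
      (∀ x ∈ tlist z, x ∉ (a i).fv ∪ (a i).bv ∪ ((b i).fv ∪ (b i).bv)) →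
      LogicalAxiom
        ((Expr.allList (tlist z) (((a i).rename (vs i).1 z).eq ((b i).rename (ws i).1 z))).imp
          ((Expr.app o vs a).eq (Expr.app o ws b)))

/-- Provability in the calculus of functional logic with the nonlogical axioms `T`. -/
inductive Provable (T : Set (Formula S)) : Formula S → Prop
  | ax (φ : Formula S) : φ ∈ T → Provable T φ
  | logical (φ : Formula S) : LogicalAxiom φ → Provable T φ
  | detachment (φ ψ : Formula S) : Provable T φ → Provable T (φ.imp ψ) → Provable T ψ
  | generalization (x : S.AnyVar) (φ : Formula S) : Provable T φ → Provable T (Expr.all x φ)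

/-- A theory is consistent if it does not prove falsum. -/
def Consistent (T : Set (Formula S)) : Prop := ¬ Provable T Expr.falsum

end Calculus

/-! ### Structures -/

/-- Normal structures of signature `S`. For `σ = ⟨σ₁,…,σₗ⟩` the selected set `fn γ σ` consists of
maps `carrier σ₁ × … × carrier σₗ → carrier γ`; for `ℓ = 0` the maps on the one-point empty product
are identified with the elements of `carrier γ`, and all of them are selected. The `i`-th argument
of `interp o` is thus an element if the `i`-th place binds no variables, and a selected function
otherwise. -/
structure NormalStructure (S : Signature.{u}) where
  carrier : S.Srt → Type u
  carrier_nonempty : ∀ α, Nonempty (carrier α)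
  fn : (γ : S.Srt) → (σ : List S.VSrt) →
    Set (List.TProd (fun s : S.VSrt => carrier s) σ → carrier γ)
  interp : (o : S.Sym) →
    ((i : Fin (S.sig o).arity) → fn ((S.sig o).argSort i) ((S.sig o).binders i)) →
    carrier (S.sig o).res
  fn_nil : ∀ γ, fn γ [] = Set.univ
  /-- constant functions -/
  fn_const : ∀ γ σ (w : carrier γ), (fun _ => w) ∈ fn γ σ
  /-- projections -/
  fn_proj : ∀ (σ : List S.VSrt) (j : Fin σ.length), (fun x => tget x j) ∈ fn (σ.get j) σ
  /-- partial fixing -/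
  fn_fix : ∀ {γ σ ρ} {g : List.TProd (fun s : S.VSrt => carrier s) (σ ++ ρ) → carrier γ},
    g ∈ fn γ (σ ++ ρ) → ∀ x : List.TProd (fun s : S.VSrt => carrier s) σ,
      (fun r => g (tappend x r)) ∈ fn γ ρ
  /-- composition -/
  fn_comp : ∀ (o : S.Sym) (σ : List S.VSrt)
    (g : (i : Fin (S.sig o).arity) →
      List.TProd (fun s : S.VSrt => carrier s) (σ ++ (S.sig o).binders i) →
        carrier ((S.sig o).argSort i))
    (hg : ∀ i, g i ∈ fn ((S.sig o).argSort i) (σ ++ (S.sig o).binders i)),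
    (fun y => interp o fun i => ⟨fun z => g i (tappend y z), fn_fix (hg i) y⟩) ∈
      fn (S.sig o).res σ
  /-- the two truth values -/
  tr : carrier S.prop
  fa : carrier S.prop
  tr_ne_fa : tr ≠ fa
  eq_tr_or_eq_fa : ∀ p : carrier S.prop, p = tr ∨ p = fa
  interp_verum : ∀ h, interp .verum h = tr
  interp_falsum : ∀ h, interp .falsum h = fa
  interp_neg : ∀ h, interp .neg h = tr ↔ ¬ (h (0 : Fin 1)).1 PUnit.unit = tr
  interp_imp : ∀ h, interp .imp h = tr ↔
    ((h (0 : Fin 2)).1 PUnit.unit = tr → (h (1 : Fin 2)).1 PUnit.unit = tr)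
  interp_and : ∀ h, interp .and h = tr ↔
    ((h (0 : Fin 2)).1 PUnit.unit = tr ∧ (h (1 : Fin 2)).1 PUnit.unit = tr)
  interp_or : ∀ h, interp .or h = tr ↔
    ((h (0 : Fin 2)).1 PUnit.unit = tr ∨ (h (1 : Fin 2)).1 PUnit.unit = tr)
  interp_all : ∀ (s : S.VSrt) (h), interp (.all s) h = tr ↔
    ∀ x : carrier s, (h (0 : Fin 1)).1 (x, PUnit.unit) = tr
  interp_ex : ∀ (s : S.VSrt) (h), interp (.ex s) h = tr ↔
    ∃ x : carrier s, (h (0 : Fin 1)).1 (x, PUnit.unit) = tr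
  /-- for `α = prop` this is also the clause for logical equivalence -/
  interp_eq : ∀ (α : S.Srt) (h), interp (.eq α) h = tr ↔
    (h (0 : Fin 2)).1 PUnit.unit = (h (1 : Fin 2)).1 PUnit.unit

namespace NormalStructure

variable {S : Signature.{u}} (M : NormalStructure S)

/-- Sequences of elements of the ranges of the sorts in `σ`. -/
abbrev Tup (σ : List S.VSrt) : Type u := List.TProd (fun s : S.VSrt => M.carrier s) σ

open Classical in
/-- The projection to the position of the last occurrence of the variable `v` in `u`. -/
noncomputable def lookup : {σ : List S.VSrt} → (u : S.VarSeq σ) → (v : S.AnyVar) → v ∈ tlist u →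
    M.Tup σ → M.carrier v.1
  | [], _, _, h, _ => absurd h List.not_mem_nil
  | s :: _, u, v, h, x =>
      if h' : v ∈ tlist u.2 then lookup u.2 v h' x.2
      else
        have e : s = v.1 := congrArg Sigma.fst ((List.mem_cons.1 h).resolve_right h').symm
        e ▸ x.1

theorem lookup_eq_proj : {σ : List S.VSrt} → (u : S.VarSeq σ) → (v : S.AnyVar) →
    (h : v ∈ tlist u) →
    ∃ (j : Fin σ.length) (e : σ.get j = v.1), M.lookup u v h = fun x => e ▸ tget x j
  | [], _, _, h => absurd h List.not_mem_nil
  | s :: σ, u, v, h => by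
      by_cases h' : v ∈ tlist u.2
      · obtain ⟨⟨j, hj⟩, e, he⟩ := lookup_eq_proj u.2 v h'
        refine ⟨⟨j + 1, Nat.succ_lt_succ hj⟩, e, ?_⟩
        funext x
        simp only [lookup, h', dif_pos, he]
        rfl
      · have e : s = v.1 := congrArg Sigma.fst ((List.mem_cons.1 h).resolve_right h').symm
        refine ⟨⟨0, Nat.succ_pos _⟩, e, ?_⟩
        funext x
        simp only [lookup, h', dif_neg, not_false_eq_true]
        rfl

theorem lookup_mem {σ : List S.VSrt} (u : S.VarSeq σ) (v : S.AnyVar) (h : v ∈ tlist u) :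
    M.lookup u v h ∈ M.fn v.1 σ := by
  obtain ⟨j, e, he⟩ := M.lookup_eq_proj u v h
  rw [he]
  have key : ∀ (t : S.VSrt) (e' : σ.get j = t),
      (fun x : M.Tup σ => (e' ▸ tget x j : M.carrier t)) ∈ M.fn t σ := by
    intro t e'
    subst e'
    exact M.fn_proj σ j
  exact key v.1 e

/-- The evaluation of an expression: it maps each perspective `u` of the sequence of sorts `σ` to a
selected function of `fn γ σ`. -/
noncomputable def eval : {γ : S.Srt} → (e : Expr S γ) → {σ : List S.VSrt} → (u : S.VarSeq σ) →
    e.Persp u → M.fn γ σ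
  | _, .var v, _, u, h =>
      have hv : v ∈ tlist u := h v (by rw [Expr.fv]; exact rfl)
      ⟨M.lookup u v hv, M.lookup_mem u v hv⟩
  | _, .app o vs args, σ, u, h =>
      ⟨fun x => M.interp o fun i =>
          ⟨fun y => (eval (args i) (tappend u (vs i).1) (h.arg i)).1 (tappend x y),
            M.fn_fix (eval (args i) (tappend u (vs i).1) (h.arg i)).2 x⟩,
        M.fn_comp o σ (fun i => (eval (args i) (tappend u (vs i).1) (h.arg i)).1)
          (fun i => (eval (args i) (tappend u (vs i).1) (h.arg i)).2)⟩

/-- `M ⊨ φ`: on every perspective, `φ` evaluates to the constant function with value true. -/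
def Satisfies (φ : Formula S) : Prop :=
  ∀ (σ : List S.VSrt) (u : S.VarSeq σ) (h : φ.Persp u) (x : M.Tup σ), (M.eval φ u h).1 x = M.tr

/-- `M ⊨ T`. -/
def Models (T : Set (Formula S)) : Prop := ∀ φ ∈ T, M.Satisfies φ

end NormalStructure

end FnlLogic

/-!
A Henkin construction yields a model of a consistent set `T` of formulas. Two devices keep it
independent of renaming of bound variables and of extensions of the signature.

*Witnesses.* The expressions are enriched by constants: `wit x φ` is a constant for every variable
`x` and every formula `φ`, which may itself contain such constants (`HExpr`). No calculus is set up
for enriched formulas. Instead, variables are put in place of the constants (`HExpr.tr`), and an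
enriched formula counts as derivable if the resulting formula is derivable from `T` for all
sufficiently fresh choices of the variables, that is, eventually along the filter `fresh`. Finitely
many such formulas can be considered at once because `fresh` is a filter, and `⊥` is not derivable
because the filter is proper. Finitely many Henkin axioms `φ[x ← wit x φ] → ∀ x φ` are consistent:
the axiom whose witness is nested most deeply can be dropped, because the variable in its place
occurs nowhere else (`not_eventually_denial`, `Provable.of_witness`). Hence any finite number of
requirements is met by a propositional valuation, and a limit along an ultrafilter of such
valuations meets all of them (`exists_isHenkin`).

*The term model.* Let `v` be the valuation obtained. The range of a sort consists of the classes of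
its closed enriched expressions modulo the equality that `v` provides; a sort without expressions
gets one element. The selected functions are the maps described by an expression `e` in distinct
variables `w` (`Represents`). An operation is applied to such maps by applying the symbol to
expressions that describe them. The congruence axiom makes this independent of the expressions
(`val_app_eq`), since by the Henkin axioms two expressions are equal for all values of their
variables as soon as all their closed instances are. The common variables required for the closure
of the selected functions under composition can be chosen so as to occur bound in none of the
expressions, so that bound variables are never renamed (`comp_mem_termFn`). By induction, the value
of an expression in the term model is the class of its closed instance (`eval_termModel`), so that
the model satisfies `T`.
-/

namespace FnlLogic

/-! ### Tuples of variables and environments -/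

section Tuples

variable {ι : Type u} {V D : ι → Type u}

/-- The tuple of values of an assignment `g` at the components of a tuple. -/
def tmapv (g : (x : Σ s, V s) → D x.1) : {σ : List ι} → List.TProd V σ → List.TProd D σ
  | [], _ => PUnit.unit
  | s :: _, u => (g ⟨s, u.1⟩, tmapv g u.2)

open Classical in
/-- The assignment `g` changed to take the values `d` at the components of `u`; at a repeated
component the rightmost value counts. -/
noncomputable def override (g : (x : Σ s, V s) → D x.1) :
    {σ : List ι} → List.TProd V σ → List.TProd D σ → (y : Σ s, V s) → D y.1
  | [], _, _ => g
  | s :: _, u, d => override (Function.update g ⟨s, u.1⟩ d.1) u.2 d.2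

open Classical in
theorem override_cons {s : ι} {σ : List ι} (g : (x : Σ s, V s) → D x.1)
    (u : List.TProd V (s :: σ)) (d : List.TProd D (s :: σ)) :
    override g u d = override (Function.update g ⟨s, u.1⟩ d.1) u.2 d.2 := rfl

theorem override_of_notMem : ∀ {σ : List ι} (g : (x : Σ s, V s) → D x.1) (u : List.TProd V σ)
    (d : List.TProd D σ) {y : Σ s, V s}, y ∉ tlist u → override g u d y = g y
  | [], _, _, _, _, _ => rfl
  | s :: _, g, u, d, y, hy => by
      classical
      have hy' : y ≠ ⟨s, u.1⟩ ∧ y ∉ tlist u.2 := by simpa [tlist] using hy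
      rw [override, override_of_notMem _ _ _ hy'.2, Function.update_of_ne hy'.1]

theorem override_head {s : ι} {σ : List ι} (g : (x : Σ s, V s) → D x.1)
    (u : List.TProd V (s :: σ)) (d : List.TProd D (s :: σ))
    (h : (⟨s, u.1⟩ : Σ s, V s) ∉ tlist (σ := σ) u.2) : override g u d ⟨s, u.1⟩ = d.1 := by
  classical
  rw [override_cons, override_of_notMem _ _ _ h, Function.update_self]

theorem override_congr : ∀ {σ : List ι} {g g' : (x : Σ s, V s) → D x.1} (u : List.TProd V σ)
    (d : List.TProd D σ) {y : Σ s, V s}, (y ∉ tlist u → g y = g' y) →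
    override g u d y = override g' u d y
  | [], _, _, _, _, _, h => h List.not_mem_nil
  | s :: _, g, g', u, d, y, h => by
      classical
      refine override_congr u.2 d.2 fun hy => ?_
      by_cases e : y = ⟨s, u.1⟩
      · subst e; simp
      · rw [Function.update_of_ne e, Function.update_of_ne e]
        exact h (by simpa [tlist, e] using hy)

theorem tmapv_congr : ∀ {σ : List ι} {g g' : (x : Σ s, V s) → D x.1} (u : List.TProd V σ),
    (∀ y ∈ tlist u, g y = g' y) → tmapv g u = tmapv g' u
  | [], _, _, _, _ => rfl
  | _ :: _, _, _, u, h => by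
      rw [tmapv, tmapv, h _ (by simp [tlist]),
        tmapv_congr u.2 fun y hy => h y (by simp [tlist, hy])]

theorem tmapv_override : ∀ {σ : List ι} (g : (x : Σ s, V s) → D x.1) (u : List.TProd V σ)
    (d : List.TProd D σ), (tlist u).Nodup → tmapv (override g u d) u = d
  | [], _, _, _, _ => rfl
  | s :: _, g, u, d, h => by
      have h' := List.nodup_cons.1 h
      rw [tmapv, override_head _ _ _ h'.1, override_cons, tmapv_override _ _ _ h'.2]
      rfl

theorem tmapv_tappend : ∀ {σ ρ : List ι} (g : (x : Σ s, V s) → D x.1) (u : List.TProd V σ)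
    (w : List.TProd V ρ), tmapv g (tappend u w) = tappend (tmapv g u) (tmapv g w)
  | [], _, _, _, _ => rfl
  | _ :: _, _, g, u, w => Prod.ext rfl (tmapv_tappend g u.2 w)

theorem override_tappend : ∀ {σ ρ : List ι} (g : (x : Σ s, V s) → D x.1) (u : List.TProd V σ)
    (w : List.TProd V ρ) (d : List.TProd D σ) (r : List.TProd D ρ),
    override g (tappend u w) (tappend d r) = override (override g u d) w r
  | [], _, _, _, _, _, _ => rfl
  | _ :: _, _, _, u, w, d, r => override_tappend _ u.2 w d.2 r

theorem tget_tmapv : ∀ {σ : List ι} (g : (x : Σ s, V s) → D x.1) (u : List.TProd V σ)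
    (j : Fin σ.length), tget (tmapv g u) j = g ⟨σ.get j, tget u j⟩
  | _ :: _, _, _, ⟨0, _⟩ => rfl
  | _ :: _, g, u, ⟨j + 1, h⟩ => tget_tmapv g u.2 ⟨j, Nat.lt_of_succ_lt_succ h⟩

theorem exists_tappend : ∀ {σ ρ : List ι} (u : List.TProd V (σ ++ ρ)),
    ∃ (a : List.TProd V σ) (b : List.TProd V ρ), u = tappend a b
  | [], _, u => ⟨PUnit.unit, u, rfl⟩
  | _ :: _, _, u => by
      obtain ⟨a, b, h⟩ := exists_tappend u.2
      exact ⟨(u.1, a), b, Prod.ext rfl h⟩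

/-- A property of the values of an overridden assignment. -/
theorem override_induction : ∀ {σ : List ι} {g : (x : Σ s, V s) → D x.1} {u : List.TProd V σ}
    {d : List.TProd D σ} {p : (s : ι) → D s → Prop} {y : Σ s, V s}, (y ∉ tlist u → p y.1 (g y)) →
    (∀ z ∈ tlist d, p z.1 z.2) → p y.1 (override g u d y)
  | [], _, _, _, _, _, h, _ => h List.not_mem_nil
  | s :: _, g, u, d, p, y, h, hd => by
      classical
      refine override_induction (u := u.2) (d := d.2) (fun hy => ?_)
        fun z hz => hd z (List.mem_cons_of_mem _ hz)
      by_cases e : y = ⟨s, u.1⟩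
      · subst e
        simpa using hd ⟨s, d.1⟩ List.mem_cons_self
      · rw [Function.update_of_ne e]
        exact h (by simpa [tlist, e] using hy)

theorem override_tmapv_self : ∀ {σ : List ι} (g g' : (x : Σ s, V s) → D x.1)
    (u : List.TProd V σ) {y : Σ s, V s}, y ∈ tlist u → override g u (tmapv g' u) y = g' y
  | [], _, _, _, _, h => absurd h List.not_mem_nil
  | s :: _, g, g', u, y, h => by
      by_cases hy : y ∈ tlist u.2
      · exact override_tmapv_self _ _ u.2 hy
      · obtain rfl : y = ⟨s, u.1⟩ := (List.mem_cons.1 h).resolve_right hy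
        exact override_head _ _ _ hy

theorem map_override_tmapv {E : ι → Type u} (k : (s : ι) → D s → E s) : ∀ {σ : List ι}
    (g g' : (x : Σ s, V s) → D x.1) (u z : List.TProd V σ) (y : Σ s, V s),
    k y.1 (override g u (tmapv g' z) y) =
      override (fun x => k x.1 (g x)) u (tmapv (fun x => k x.1 (g' x)) z) y
  | [], _, _, _, _, _ => rfl
  | s :: _, g, g', u, z, y => by
      classical
      rw [override_cons, override_cons]
      refine (map_override_tmapv k _ _ u.2 z.2 y).trans ?_
      refine congrFun (congrArg (fun f => override f u.2 _) (funext fun x => ?_)) y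
      by_cases e : x = ⟨s, u.1⟩
      · subst e; simp [tmapv]
      · simp [e]

end Tuples

/-! ### Expressions: variables and substitution -/

theorem exists_fresh {S : Signature.{u}} {F : Set S.AnyVar} (hF : F.Finite) (s : S.VSrt) :
    ∃ z : S.Var s, (⟨s, z⟩ : S.AnyVar) ∉ F := by
  obtain ⟨e⟩ := S.var_enumerable s
  have : Infinite (S.Var s) := e.infinite_iff.2 inferInstance
  have hF' : {z : S.Var s | (⟨s, z⟩ : S.AnyVar) ∈ F}.Finite :=
    hF.preimage (sigma_mk_injective.injOn)
  exact hF'.exists_notMem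

theorem exists_fresh_seq {S : Signature.{u}} {F : Set S.AnyVar} (hF : F.Finite) :
    ∀ σ : List S.VSrt, ∃ v : S.VarSeq σ, (tlist v).Nodup ∧ ∀ x ∈ tlist v, x ∉ F
  | [] => ⟨PUnit.unit, List.nodup_nil, fun _ h => absurd h List.not_mem_nil⟩
  | s :: σ => by
      obtain ⟨z, hz⟩ := exists_fresh hF s
      obtain ⟨v, hv, hvF⟩ := exists_fresh_seq (hF.insert ⟨s, z⟩) σ
      refine ⟨(z, v), List.nodup_cons.2 ⟨fun h => hvF _ h (Set.mem_insert _ _), hv⟩, ?_⟩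
      intro x hx
      rcases List.mem_cons.1 hx with rfl | hx
      · exact hz
      · exact fun h => hvF x hx (Set.mem_insert_of_mem _ h)

namespace Expr

variable {S : Signature.{u}}

theorem finite_fv : {γ : S.Srt} → (e : Expr S γ) → e.fv.Finite
  | _, var _ => by rw [fv]; exact Set.finite_singleton _
  | _, app _ _ args => by
      rw [fv]; exact Set.finite_iUnion fun i => (finite_fv (args i)).sdiff

theorem finite_bv : {γ : S.Srt} → (e : Expr S γ) → e.bv.Finite
  | _, var _ => by rw [bv]; exact Set.finite_empty
  | _, app _ vs args => by
      rw [bv]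
      exact Set.finite_iUnion fun i => (finite_bv (args i)).union (List.finite_toSet _)

theorem subst_congr : {γ : S.Srt} → (e : Expr S γ) → {θ θ' : (x : S.AnyVar) → Expr S x.1} →
    (∀ x ∈ e.fv, θ x = θ' x) → e.subst θ = e.subst θ'
  | _, var x, _, _, h => by rw [subst, subst]; exact h x (by rw [fv]; rfl)
  | _, app o vs args, θ, θ', h => by
      rw [subst, subst]
      congr 1
      funext i
      refine subst_congr (args i) fun x hx => ?_
      by_cases hv : x ∈ tlist (vs i).1
      · simp [hv]
      · simp only [hv, if_false]
        exact h x (by rw [fv]; exact Set.mem_iUnion.2 ⟨i, hx, hv⟩)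

/-- Two successive substitutions, the first of which is not affected by the bound variables,
amount to one. -/
theorem subst_subst : {γ : S.Srt} → (e : Expr S γ) → (θ η : (x : S.AnyVar) → Expr S x.1) →
    (∀ x, ∀ y ∈ (θ x).fv, y = x ∨ y ∉ e.bv) →
    (e.subst θ).subst η = e.subst fun x => (θ x).subst η
  | _, var x, θ, η, _ => by rw [subst, subst]
  | _, app o vs args, θ, η, h => by
      rw [subst, subst, subst]
      congr 1
      funext i
      rw [subst_subst (args i)]
      · refine subst_congr _ fun x _ => ?_
        by_cases hv : x ∈ tlist (vs i).1
        · simp [hv, subst]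
        · simp only [hv, if_false]
          refine subst_congr _ fun y hy => ?_
          rw [if_neg]
          rcases h x y hy with rfl | h
          · exact hv
          · exact fun hy' => h (by rw [bv]; exact Set.mem_iUnion.2 ⟨i, Or.inr hy'⟩)
      · intro x y hy
        by_cases hv : x ∈ tlist (vs i).1
        · rw [if_pos hv, fv] at hy
          exact Or.inl hy
        · rw [if_neg hv] at hy
          refine (h x y hy).imp_right fun h hb => h ?_
          rw [bv]; exact Set.mem_iUnion.2 ⟨i, Or.inl hb⟩

theorem substitutable_of_disjoint {δ : S.Srt} (d : Expr S δ) (x : S.AnyVar) :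
    {γ : S.Srt} → (e : Expr S γ) → (∀ y ∈ d.fv, y ∉ e.bv) → d.Substitutable x e
  | _, var _, _ => by rw [Substitutable]; trivial
  | _, app _ vs args, h => by
      rw [Substitutable]
      refine fun i => Or.inr ⟨substitutable_of_disjoint d x (args i) fun y hy hb => h y hy ?_,
        fun y hy hb => h y hy ?_⟩
      · rw [bv]; exact Set.mem_iUnion.2 ⟨i, Or.inl hb⟩
      · rw [bv]; exact Set.mem_iUnion.2 ⟨i, Or.inr hb⟩

theorem single_self (x : S.AnyVar) (a : Expr S x.1) : single x a x = a := by
  classical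
  simp [single]

theorem single_of_ne {x y : S.AnyVar} (h : y ≠ x) (a : Expr S x.1) : single x a y = var y := by
  classical
  simp [single, h]

theorem seqSubst_eq_override : ∀ {σ : List S.VSrt} (θ : (y : S.AnyVar) → Expr S y.1)
    (x : S.VarSeq σ) (d : List.TProd (fun s : S.VSrt => Expr S s) σ),
    seqSubst θ x d = override (D := fun s : S.VSrt => Expr S s) θ x d
  | [], _, _, _ => rfl
  | _ :: _, _, x, d => by
      rw [seqSubst, override, seqSubst_eq_override _ x.2 d.2]
      congr!

theorem varSeq_eq_tmapv : ∀ {σ : List S.VSrt} (x : S.VarSeq σ),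
    varSeq x = tmapv (D := fun s : S.VSrt => Expr S s) var x
  | [], _ => rfl
  | _ :: _, x => Prod.ext rfl (varSeq_eq_tmapv x.2)

/-- The substitution that replaces the variables `v` by the variables `z`. -/
noncomputable def varRename {σ : List S.VSrt} (v z : S.VarSeq σ) : (y : S.AnyVar) → Expr S y.1 :=
  seqSubst var v (varSeq z)

theorem varRename_of_notMem {σ : List S.VSrt} (v z : S.VarSeq σ) {y : S.AnyVar}
    (hy : y ∉ tlist v) : varRename v z y = var y := by
  rw [varRename, seqSubst_eq_override, override_of_notMem _ _ _ hy]

theorem exists_varRename_eq_var {σ : List S.VSrt} (v z : S.VarSeq σ) (y : S.AnyVar) :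
    ∃ (w : S.Var y.1), varRename v z y = var ⟨y.1, w⟩ ∧
      ((⟨y.1, w⟩ : S.AnyVar) = y ∧ y ∉ tlist v ∨ (⟨y.1, w⟩ : S.AnyVar) ∈ tlist z) := by
  rw [varRename, seqSubst_eq_override, varSeq_eq_tmapv]
  have key : ∀ {σ : List S.VSrt} (z : S.VarSeq σ) (p),
      p ∈ tlist (tmapv (D := fun s : S.VSrt => Expr S s) var z) →
      ∃ w : S.Var p.1, p.2 = var ⟨p.1, w⟩ ∧ (⟨p.1, w⟩ : S.AnyVar) ∈ tlist z := by
    intro σ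
    induction σ with
    | nil => exact fun _ _ h => absurd h List.not_mem_nil
    | cons s σ ih =>
      intro z p hp
      rcases List.mem_cons.1 hp with rfl | hp
      · exact ⟨z.1, rfl, List.mem_cons_self⟩
      · obtain ⟨w, h, hw⟩ := ih z.2 p hp
        exact ⟨w, h, List.mem_cons_of_mem _ hw⟩
  refine @override_induction _ _ (fun s : S.VSrt => Expr S s) _ var v _
    (fun s d => ∃ w : S.Var s, d = var ⟨s, w⟩ ∧
      ((⟨s, w⟩ : S.AnyVar) = y ∧ y ∉ tlist v ∨ (⟨s, w⟩ : S.AnyVar) ∈ tlist z)) y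
    (fun hy => ⟨y.2, rfl, Or.inl ⟨rfl, hy⟩⟩) ?_
  intro p hp
  obtain ⟨w, h, hw⟩ := key z p hp
  exact ⟨w, h, Or.inr hw⟩

end Expr

/-! ### Derivations -/

section Calculus

variable {S : Signature.{u}} {T : Set (Formula S)}

/-- The formula that denies the conjunction of the members of a list. -/
def denial : List (Formula S) → Formula S
  | [] => Expr.falsum
  | φ :: l => φ.imp (denial l)

theorem IsValuation.denial_iff {w : Formula S → Prop} (hw : IsValuation w) :
    ∀ l : List (Formula S), w (denial l) ↔ ∃ φ ∈ l, ¬ w φ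
  | [] => by simp [denial, hw.falsum]
  | φ :: l => by simp [denial, hw.imp, hw.denial_iff l]; tauto

theorem Expr.fv_imp (φ ψ : Formula S) : (φ.imp ψ).fv = φ.fv ∪ ψ.fv := by
  ext x
  rw [imp, fv]
  simp only [Set.mem_iUnion, Set.mem_union]
  constructor
  · rintro ⟨i, hi⟩
    fin_cases i
    · exact Or.inl hi.1
    · exact Or.inr hi.1
  · rintro (h | h)
    · exact ⟨(0 : Fin 2), h, List.not_mem_nil⟩
    · exact ⟨(1 : Fin 2), h, List.not_mem_nil⟩

theorem Expr.fv_falsum : (falsum : Formula S).fv = ∅ := by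
  rw [falsum, fv]
  exact Set.iUnion_eq_empty.2 fun i => i.elim0

theorem fv_denial {x : S.AnyVar} : ∀ {l : List (Formula S)}, x ∈ (denial l).fv → ∃ φ ∈ l, x ∈ φ.fv
  | [], h => by rw [denial, Expr.fv_falsum] at h; exact h.elim
  | φ :: l, h => by
      rw [denial, Expr.fv_imp] at h
      rcases h with h | h
      · exact ⟨φ, List.mem_cons_self, h⟩
      · obtain ⟨ψ, hψ, h⟩ := fv_denial h
        exact ⟨ψ, List.mem_cons_of_mem _ hψ, h⟩

/-- Provability is closed under propositional consequence. -/
theorem Provable.of_forall_valuation : ∀ (l : List (Formula S)) {ψ : Formula S},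
    (∀ φ ∈ l, Provable T φ) → (∀ w, IsValuation w → (∀ φ ∈ l, w φ) → w ψ) → Provable T ψ
  | [], ψ, _, h => .logical _ (.taut _ fun w hw => h w hw (by simp))
  | φ :: l, ψ, hl, h => by
      refine .detachment φ ψ (hl φ List.mem_cons_self) (of_forall_valuation l
        (fun χ hχ => hl χ (List.mem_cons_of_mem _ hχ)) fun w hw hwl => (hw.imp _ _).2 fun hφ => ?_)
      exact h w hw (by simpa [hφ] using hwl)

/-- Renaming of a quantified variable. -/
theorem Provable.all_eq_all {x : S.AnyVar} {φ : Formula S} {y : S.Var x.1}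
    (hf : (⟨x.1, y⟩ : S.AnyVar) ∉ φ.fv) (hb : (⟨x.1, y⟩ : S.AnyVar) ∉ φ.bv) :
    Provable T ((Expr.all x φ).iff
      (Expr.all ⟨x.1, y⟩ (φ.subst (Expr.single x (.var ⟨x.1, y⟩))))) := by
  set ψ := φ.subst (Expr.single x (.var ⟨x.1, y⟩)) with hψ
  obtain ⟨z, hz⟩ := exists_fresh
    (φ.finite_fv.union φ.finite_bv |>.union (ψ.finite_fv.union ψ.finite_bv)) x.1
  refine .detachment _ _ ?_ (.logical _ (.eq_congr (.all x.1) (0 : Fin 1)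
    (fun _ => ⟨(x.2, PUnit.unit), List.nodup_singleton _⟩)
    (fun _ => ⟨(y, PUnit.unit), List.nodup_singleton _⟩) (fun _ => φ) (fun _ => ψ)
    (z, PUnit.unit) ?_ (List.nodup_singleton _) ?_))
  · have key : ψ.subst (Expr.single ⟨x.1, y⟩ (.var ⟨x.1, z⟩)) =
        φ.subst (Expr.single x (.var ⟨x.1, z⟩)) := by
      rw [hψ, Expr.subst_subst]
      · refine Expr.subst_congr _ fun v hv => ?_
        have hvy : v ≠ ⟨x.1, y⟩ := fun h => hf (h ▸ hv)
        by_cases hvx : v = x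
        · subst hvx
          rw [Expr.single_self, Expr.single_self, Expr.subst, Expr.single_self]
        · rw [Expr.single_of_ne hvx, Expr.single_of_ne hvx, Expr.subst, Expr.single_of_ne hvy]
      · intro v w hw
        by_cases hvx : v = x
        · subst hvx
          rw [Expr.single_self, Expr.fv] at hw
          obtain rfl := Set.mem_singleton_iff.1 hw
          exact Or.inr hb
        · rw [Expr.single_of_ne hvx, Expr.fv] at hw
          exact Or.inl hw
    refine .generalization _ _ (.logical _ ?_)
    change LogicalAxiom (Expr.eq (φ.subst (Expr.single x (.var ⟨x.1, z⟩)))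
      (ψ.subst (Expr.single ⟨x.1, y⟩ (.var ⟨x.1, z⟩))))
    rw [key]
    exact .eq_refl _
  · exact fun j hj => (hj (Subsingleton.elim (α := Fin 1) _ _)).elim
  · intro v hv
    obtain rfl := List.mem_singleton.1 hv
    exact hz

/-- A premise `φ(y) → ∀ x φ` with a fresh variable `y` can be dropped: the semantic content of the
Henkin witnesses inside the calculus. -/
theorem Provable.of_witness {x : S.AnyVar} {φ ψ : Formula S} {y : S.Var x.1}
    (hf : (⟨x.1, y⟩ : S.AnyVar) ∉ φ.fv) (hb : (⟨x.1, y⟩ : S.AnyVar) ∉ φ.bv)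
    (hψ : (⟨x.1, y⟩ : S.AnyVar) ∉ ψ.fv)
    (h : Provable T (((φ.subst (Expr.single x (.var ⟨x.1, y⟩))).imp (Expr.all x φ)).imp ψ)) :
    Provable T ψ := by
  set χ := φ.subst (Expr.single x (.var ⟨x.1, y⟩))
  have h1 : Provable T ((ψ.imp .falsum).imp χ) :=
    .of_forall_valuation [_] (by simpa using h) fun w hw => by
      simp only [List.forall_mem_singleton, hw.imp]
      have := hw.falsum
      tauto
  have h2 := Provable.detachment _ _ (.generalization ⟨x.1, y⟩ _ h1)
    (.logical _ (.all_imp ⟨x.1, y⟩ χ (ψ.imp .falsum)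
      (by rw [Expr.fv_imp, Expr.fv_falsum, Set.union_empty]; exact hψ)))
  refine .of_forall_valuation [_, _, _] (by
    simpa using And.intro h (And.intro h2 (Provable.all_eq_all (T := T) hf hb))) fun w hw => ?_
  simp only [List.mem_cons, List.not_mem_nil, or_false, forall_eq_or_imp, forall_eq, hw.imp, hw.iff]
  have := hw.falsum
  tauto

theorem Provable.allList {φ : Formula S} (h : Provable T φ) :
    ∀ l : List S.AnyVar, Provable T (Expr.allList l φ)
  | [] => h
  | z :: l => .generalization z _ (h.allList l)

end Calculus

/-! ### Expressions with Henkin witnesses -/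

/-- Expressions enriched by a constant `wit x φ` for every variable `x` and every enriched formula
`φ`, intended as a counterexample to `∀ x φ` if there is one. The formula is only part of the name
of the constant: nothing in it counts as an occurrence of a variable, and substitution does not
enter it. -/
inductive HExpr (S : Signature.{u}) : S.Srt → Type u
  | var (x : S.AnyVar) : HExpr S x.1
  | wit (x : S.AnyVar) (φ : HExpr S S.prop) : HExpr S x.1
  | app (o : S.Sym)
      (vs : (i : Fin (S.sig o).arity) →
        {v : S.VarSeq ((S.sig o).binders i) // (tlist v).Nodup})
      (args : (i : Fin (S.sig o).arity) → HExpr S ((S.sig o).argSort i)) :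
      HExpr S (S.sig o).res

/-- The formulas with Henkin witnesses. -/
abbrev HFormula (S : Signature.{u}) : Type u := HExpr S S.prop

/-- The name of the Henkin witness `wit x φ` is the pair `(x, φ)`. -/
abbrev WitName (S : Signature.{u}) : Type u := S.AnyVar × HFormula S

/-- An assignment of variables of the right sorts to Henkin witnesses. -/
abbrev Naming (S : Signature.{u}) : Type u := (n : WitName S) → S.Var n.1.1

/-- The variable assigned to a witness, together with its sort. -/
def Naming.toVar {S : Signature.{u}} (ρ : Naming S) (n : WitName S) : S.AnyVar := ⟨n.1.1, ρ n⟩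

namespace HExpr

variable {S : Signature.{u}}

def falsum : HFormula S := app .falsum (fun i => i.elim0) (fun i => i.elim0)

def imp (φ ψ : HFormula S) : HFormula S :=
  app .imp (fun _ => ⟨PUnit.unit, List.nodup_nil⟩) ![φ, ψ]

def eq {α : S.Srt} (a b : HExpr S α) : HFormula S :=
  app (.eq α) (fun _ => ⟨PUnit.unit, List.nodup_nil⟩) ![a, b]

def all (x : S.AnyVar) (φ : HFormula S) : HFormula S :=
  app (.all x.1) (fun _ => ⟨(x.2, PUnit.unit), List.nodup_singleton _⟩) (fun _ => φ)

def ex (x : S.AnyVar) (φ : HFormula S) : HFormula S :=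
  app (.ex x.1) (fun _ => ⟨(x.2, PUnit.unit), List.nodup_singleton _⟩) (fun _ => φ)

def allList : List S.AnyVar → HFormula S → HFormula S
  | [], φ => φ
  | z :: zs, φ => all z (allList zs φ)

/-- Free variables. -/
def fv : {γ : S.Srt} → HExpr S γ → Set S.AnyVar
  | _, var x => {x}
  | _, wit _ _ => ∅
  | _, app _ vs args => ⋃ i, fv (args i) \ {x | x ∈ tlist (vs i).1}

/-- Bound variables. -/
def bv : {γ : S.Srt} → HExpr S γ → Set S.AnyVar
  | _, var _ => ∅
  | _, wit _ _ => ∅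
  | _, app _ vs args => ⋃ i, bv (args i) ∪ {x | x ∈ tlist (vs i).1}

/-- The names of the witnesses that occur, not counting occurrences inside names. -/
def names : {γ : S.Srt} → HExpr S γ → Set (WitName S)
  | _, var _ => ∅
  | _, wit x φ => {(x, φ)}
  | _, app _ _ args => ⋃ i, names (args i)

/-- The nesting depth of names of witnesses. -/
def rank : {γ : S.Srt} → HExpr S γ → ℕ
  | _, var _ => 0
  | _, wit _ φ => rank φ + 1
  | _, app _ _ args => Finset.univ.sup fun i => rank (args i)

/-- A closed expression has no free variables. -/
def Closed {γ : S.Srt} (e : HExpr S γ) : Prop := e.fv = ∅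

open Classical in
/-- The substitution `θ` with the variables of the list `l` exempted. -/
noncomputable def mask (l : List S.AnyVar) (θ : (x : S.AnyVar) → HExpr S x.1) (x : S.AnyVar) :
    HExpr S x.1 :=
  if x ∈ l then var x else θ x

/-- Simultaneous replacement of the free variables. -/
noncomputable def subst : {γ : S.Srt} → HExpr S γ → ((x : S.AnyVar) → HExpr S x.1) → HExpr S γ
  | _, var x, θ => θ x
  | _, wit x φ, _ => wit x φ
  | _, app o vs args, θ => app o vs fun i => subst (args i) (mask (tlist (vs i).1) θ)

open Classical in
/-- The replacement of a single variable. -/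
noncomputable def single (x : S.AnyVar) (a : HExpr S x.1) : (y : S.AnyVar) → HExpr S y.1 :=
  Function.update var x a

/-- The ordinary expression that arises if variables are put in place of the witnesses. -/
def tr (ρ : Naming S) : {γ : S.Srt} → HExpr S γ → Expr S γ
  | _, var x => .var x
  | _, wit x φ => .var ⟨x.1, ρ (x, φ)⟩
  | _, app o vs args => .app o vs fun i => tr ρ (args i)

/-- An ordinary expression as an expression with witnesses. -/
def emb : {γ : S.Srt} → Expr S γ → HExpr S γ
  | _, .var x => var x
  | _, .app o vs args => app o vs fun i => emb (args i)

theorem mask_of_mem {l : List S.AnyVar} {x : S.AnyVar} (h : x ∈ l)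
    (θ : (x : S.AnyVar) → HExpr S x.1) : mask l θ x = var x := if_pos h

theorem mask_of_notMem {l : List S.AnyVar} {x : S.AnyVar} (h : x ∉ l)
    (θ : (x : S.AnyVar) → HExpr S x.1) : mask l θ x = θ x := if_neg h

theorem mask_nil (θ : (x : S.AnyVar) → HExpr S x.1) : mask [] θ = θ :=
  funext fun _ => mask_of_notMem List.not_mem_nil _

theorem single_self (x : S.AnyVar) (a : HExpr S x.1) : single x a x = a := by
  classical
  simp [single]

theorem single_of_ne {x y : S.AnyVar} (h : y ≠ x) (a : HExpr S x.1) : single x a y = var y := by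
  classical
  simp [single, h]

theorem finite_fv : {γ : S.Srt} → (e : HExpr S γ) → e.fv.Finite
  | _, var _ => by rw [fv]; exact Set.finite_singleton _
  | _, wit _ _ => by rw [fv]; exact Set.finite_empty
  | _, app _ _ args => by
      rw [fv]; exact Set.finite_iUnion fun i => (finite_fv (args i)).sdiff

theorem finite_bv : {γ : S.Srt} → (e : HExpr S γ) → e.bv.Finite
  | _, var _ => by rw [bv]; exact Set.finite_empty
  | _, wit _ _ => by rw [bv]; exact Set.finite_empty
  | _, app _ vs args => by
      rw [bv]
      exact Set.finite_iUnion fun i => (finite_bv (args i)).union (List.finite_toSet _)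

theorem finite_names : {γ : S.Srt} → (e : HExpr S γ) → e.names.Finite
  | _, var _ => by rw [names]; exact Set.finite_empty
  | _, wit _ _ => by rw [names]; exact Set.finite_singleton _
  | _, app _ _ args => by rw [names]; exact Set.finite_iUnion fun i => finite_names (args i)

/-- A witness does not occur in the formula it is a witness for. -/
theorem rank_lt_of_mem_names {n : WitName S} : {γ : S.Srt} → (e : HExpr S γ) → n ∈ e.names →
    n.2.rank < e.rank
  | _, var _, h => by rw [names] at h; exact h.elim
  | _, wit x φ, h => by
      rw [names] at h
      obtain rfl := Set.mem_singleton_iff.1 h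
      rw [rank]
      exact Nat.lt_succ_self _
  | _, app _ _ args, h => by
      rw [names] at h
      obtain ⟨i, hi⟩ := Set.mem_iUnion.1 h
      rw [rank]
      exact (rank_lt_of_mem_names (args i) hi).trans_le
        (Finset.le_sup (f := fun i => rank (args i)) (Finset.mem_univ i))

theorem subst_congr : {γ : S.Srt} → (e : HExpr S γ) → {θ θ' : (x : S.AnyVar) → HExpr S x.1} →
    (∀ x ∈ e.fv, θ x = θ' x) → e.subst θ = e.subst θ'
  | _, var x, _, _, h => by rw [subst, subst]; exact h x (by rw [fv]; rfl)
  | _, wit _ _, _, _, _ => by rw [subst, subst]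
  | _, app o vs args, θ, θ', h => by
      rw [subst, subst]
      congr 1
      funext i
      refine subst_congr (args i) fun x hx => ?_
      by_cases hv : x ∈ tlist (vs i).1
      · rw [mask_of_mem hv, mask_of_mem hv]
      · rw [mask_of_notMem hv, mask_of_notMem hv]
        exact h x (by rw [fv]; exact Set.mem_iUnion.2 ⟨i, hx, hv⟩)

theorem subst_var : {γ : S.Srt} → (e : HExpr S γ) → e.subst var = e
  | _, var x => by rw [subst]
  | _, wit _ _ => by rw [subst]
  | _, app o vs args => by
      rw [subst]
      congr 1
      funext i
      rw [show mask (tlist (vs i).1) var = (var : (x : S.AnyVar) → _) from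
        funext fun x => ite_self _]
      exact subst_var (args i)

theorem Closed.subst_eq {γ : S.Srt} {e : HExpr S γ} (h : e.Closed)
    (θ : (x : S.AnyVar) → HExpr S x.1) : e.subst θ = e :=
  (subst_congr e fun x hx => by rw [Closed] at h; rw [h] at hx; exact hx.elim).trans (subst_var e)

/-- Two successive substitutions, the first of which is not affected by the bound variables,
amount to one. -/
theorem subst_subst : {γ : S.Srt} → (e : HExpr S γ) → (θ η : (x : S.AnyVar) → HExpr S x.1) →
    (∀ x, ∀ y ∈ (θ x).fv, y = x ∨ y ∉ e.bv) →
    (e.subst θ).subst η = e.subst fun x => (θ x).subst η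
  | _, var _, θ, η, _ => by rw [subst, subst]
  | _, wit _ _, θ, η, _ => by rw [subst, subst, subst]
  | _, app o vs args, θ, η, h => by
      rw [subst, subst, subst]
      congr 1
      funext i
      rw [subst_subst (args i)]
      · refine subst_congr _ fun x _ => ?_
        by_cases hv : x ∈ tlist (vs i).1
        · rw [mask_of_mem hv, mask_of_mem hv, subst, mask_of_mem hv]
        · rw [mask_of_notMem hv, mask_of_notMem hv]
          refine subst_congr _ fun y hy => mask_of_notMem ?_ _
          rcases h x y hy with rfl | h
          · exact hv
          · exact fun hy' => h (by rw [bv]; exact Set.mem_iUnion.2 ⟨i, Or.inr hy'⟩)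
      · intro x y hy
        by_cases hv : x ∈ tlist (vs i).1
        · rw [mask_of_mem hv, fv] at hy
          exact Or.inl hy
        · rw [mask_of_notMem hv] at hy
          refine (h x y hy).imp_right fun h hb => h ?_
          rw [bv]; exact Set.mem_iUnion.2 ⟨i, Or.inl hb⟩

theorem exists_of_mem_fv_subst : {γ : S.Srt} → (e : HExpr S γ) →
    {θ : (x : S.AnyVar) → HExpr S x.1} → {x : S.AnyVar} → x ∈ (e.subst θ).fv →
    ∃ y ∈ e.fv, x ∈ (θ y).fv
  | _, var y, _, _, h => ⟨y, by rw [fv]; rfl, by rwa [subst] at h⟩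
  | _, wit _ _, _, _, h => by rw [subst, fv] at h; exact h.elim
  | _, app o vs args, θ, x, h => by
      rw [subst, fv] at h
      obtain ⟨i, hi, hx⟩ := Set.mem_iUnion.1 h
      obtain ⟨y, hy, hxy⟩ := exists_of_mem_fv_subst (args i) hi
      by_cases hv : y ∈ tlist (vs i).1
      · rw [mask_of_mem hv, fv] at hxy
        obtain rfl := Set.mem_singleton_iff.1 hxy
        exact (hx hv).elim
      · rw [mask_of_notMem hv] at hxy
        exact ⟨y, by rw [fv]; exact Set.mem_iUnion.2 ⟨i, hy, hv⟩, hxy⟩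

theorem closed_subst {γ : S.Srt} (e : HExpr S γ) {θ : (x : S.AnyVar) → HExpr S x.1}
    (h : ∀ x, (θ x).Closed) : (e.subst θ).Closed :=
  Set.eq_empty_of_forall_notMem fun x hx => by
    obtain ⟨y, -, hy⟩ := exists_of_mem_fv_subst e hx
    have := h y
    rw [Closed] at this
    rw [this] at hy
    exact hy

theorem closed_wit (x : S.AnyVar) (φ : HFormula S) : (wit x φ).Closed := by rw [Closed, fv]

theorem closed_falsum : (falsum : HFormula S).Closed := by
  rw [falsum, Closed, fv]
  exact Set.iUnion_eq_empty.2 fun i => i.elim0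

theorem mem_names_subst {n : WitName S} : {γ : S.Srt} → (e : HExpr S γ) →
    {θ : (x : S.AnyVar) → HExpr S x.1} → n ∈ (e.subst θ).names →
    n ∈ e.names ∨ ∃ x, n ∈ (θ x).names
  | _, var x, _, h => Or.inr ⟨x, by rwa [subst] at h⟩
  | _, wit _ _, _, h => Or.inl (by rwa [subst] at h)
  | _, app o vs args, θ, h => by
      rw [subst, names] at h
      obtain ⟨i, hi⟩ := Set.mem_iUnion.1 h
      rcases mem_names_subst (args i) hi with h | ⟨x, hx⟩
      · exact Or.inl (by rw [names]; exact Set.mem_iUnion.2 ⟨i, h⟩)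
      · by_cases hv : x ∈ tlist (vs i).1
        · rw [mask_of_mem hv, names] at hx
          exact hx.elim
        · exact Or.inr ⟨x, by rwa [mask_of_notMem hv] at hx⟩

theorem names_imp (φ ψ : HFormula S) : (φ.imp ψ).names = φ.names ∪ ψ.names := by
  ext n
  rw [imp, names]
  simp only [Set.mem_iUnion, Set.mem_union]
  constructor
  · rintro ⟨i, hi⟩
    fin_cases i
    · exact Or.inl hi
    · exact Or.inr hi
  · rintro (h | h)
    · exact ⟨(0 : Fin 2), h⟩
    · exact ⟨(1 : Fin 2), h⟩

theorem names_all (x : S.AnyVar) (φ : HFormula S) : (all x φ).names = φ.names := by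
  rw [all, names]
  exact @Set.iUnion_const _ (Fin 1) inferInstance φ.names

/-! ### Variables in place of witnesses -/

variable (ρ : Naming S)

theorem tr_emb : {γ : S.Srt} → (e : Expr S γ) → (emb e).tr ρ = e
  | _, .var _ => by rw [emb, tr]
  | _, .app _ _ args => by
      rw [emb, tr]
      congr 1
      funext i
      exact tr_emb (args i)

theorem bv_tr : {γ : S.Srt} → (e : HExpr S γ) → (e.tr ρ).bv = e.bv
  | _, var _ => by rw [tr, bv, Expr.bv]
  | _, wit _ _ => by rw [tr, bv, Expr.bv]
  | _, app _ _ _ => by simp only [tr, bv, Expr.bv, bv_tr]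

theorem mem_fv_tr {x : S.AnyVar} : {γ : S.Srt} → (e : HExpr S γ) → x ∈ (e.tr ρ).fv →
    x ∈ e.fv ∨ ∃ n ∈ e.names, x = ρ.toVar n
  | _, var _, h => Or.inl (by rwa [tr, Expr.fv] at h)
  | _, wit y φ, h => by
      rw [tr, Expr.fv] at h
      exact Or.inr ⟨(y, φ), by rw [names]; rfl, h⟩
  | _, app o vs args, h => by
      rw [tr, Expr.fv] at h
      obtain ⟨i, hi, hx⟩ := Set.mem_iUnion.1 h
      rcases mem_fv_tr (args i) hi with h | ⟨n, hn, h⟩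
      · exact Or.inl (by rw [fv]; exact Set.mem_iUnion.2 ⟨i, h, hx⟩)
      · exact Or.inr ⟨n, by rw [names]; exact Set.mem_iUnion.2 ⟨i, hn⟩, h⟩

/-- Substitution commutes with `tr` if it leaves the variables alone that stand for witnesses. -/
theorem tr_subst : {γ : S.Srt} → (e : HExpr S γ) → {θ : (x : S.AnyVar) → HExpr S x.1} →
    {η : (x : S.AnyVar) → Expr S x.1} → (∀ x, η x = (θ x).tr ρ) →
    (∀ n ∈ e.names, η (ρ.toVar n) = .var (ρ.toVar n)) → (e.subst θ).tr ρ = (e.tr ρ).subst η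
  | _, var _, θ, η, h, _ => by rw [subst, tr, Expr.subst, h]
  | _, wit x φ, θ, η, _, h => by
      rw [subst, tr, Expr.subst]
      exact (h (x, φ) (by rw [names]; rfl)).symm
  | _, app o vs args, θ, η, h, hn => by
      rw [subst, tr, tr, Expr.subst]
      congr 1
      funext i
      refine tr_subst (args i) (fun x => ?_) fun n hn' => ?_
      · by_cases hv : x ∈ tlist (vs i).1
        · rw [mask_of_mem hv, if_pos hv, tr]
        · rw [mask_of_notMem hv, if_neg hv, h]
      · rw [hn n (by rw [names]; exact Set.mem_iUnion.2 ⟨i, hn'⟩), ite_self]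

theorem tr_subst_single {γ : S.Srt} (e : HExpr S γ) (x : S.AnyVar) (a : HExpr S x.1)
    (h : ∀ n ∈ e.names, ρ.toVar n ≠ x) :
    (e.subst (single x a)).tr ρ = (e.tr ρ).subst (Expr.single x (a.tr ρ)) := by
  refine tr_subst ρ e (fun y => ?_) fun n hn => Expr.single_of_ne (h n hn) _
  by_cases hy : y = x
  · subst hy
    rw [single_self, Expr.single_self]
  · rw [single_of_ne hy, Expr.single_of_ne hy, tr]

/-- The replacement of the variables `v` by the variables `z`. -/
noncomputable def rename {γ : S.Srt} (e : HExpr S γ) {σ : List S.VSrt} (v z : S.VarSeq σ) :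
    HExpr S γ :=
  e.subst fun x => emb (Expr.varRename v z x)

theorem tr_rename {γ : S.Srt} (e : HExpr S γ) {σ : List S.VSrt} (v z : S.VarSeq σ)
    (h : ∀ n ∈ e.names, ρ.toVar n ∉ tlist v) :
    (e.rename v z).tr ρ = (e.tr ρ).rename v z :=
  tr_subst ρ e (fun _ => (tr_emb ρ _).symm) fun n hn => Expr.varRename_of_notMem _ _ (h n hn)

theorem tr_falsum : (falsum : HFormula S).tr ρ = .falsum := by
  rw [falsum, tr, Expr.falsum]
  congr 1
  funext i
  exact i.elim0

theorem tr_imp (φ ψ : HFormula S) : (φ.imp ψ).tr ρ = (φ.tr ρ).imp (ψ.tr ρ) := by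
  rw [imp, tr, Expr.imp]
  congr 1
  funext i
  revert i
  exact Fin.forall_fin_two.2 ⟨rfl, rfl⟩

theorem tr_eq {α : S.Srt} (a b : HExpr S α) : (a.eq b).tr ρ = (a.tr ρ).eq (b.tr ρ) := by
  rw [eq, tr, Expr.eq]
  congr 1
  funext i
  revert i
  exact Fin.forall_fin_two.2 ⟨rfl, rfl⟩

theorem tr_all (x : S.AnyVar) (φ : HFormula S) : (all x φ).tr ρ = .all x (φ.tr ρ) := by
  rw [all, tr, Expr.all]

theorem tr_ex (x : S.AnyVar) (φ : HFormula S) : (ex x φ).tr ρ = .ex x (φ.tr ρ) := by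
  rw [ex, tr, Expr.ex]

theorem tr_allList (φ : HFormula S) :
    ∀ l : List S.AnyVar, (allList l φ).tr ρ = .allList l (φ.tr ρ)
  | [] => rfl
  | z :: l => by rw [allList, tr_all, tr_allList φ l, Expr.allList]

end HExpr

/-! ### Fresh namings -/

section Fresh

variable {S : Signature.{u}}

/-- The filter of fresh namings: a property holds eventually if it holds for all namings that are
injective on a suitable finite set of witnesses and avoid a suitable finite set of variables. -/
def fresh (S : Signature.{u}) : Filter (Naming S) where
  sets := {U | ∃ (K : Set (WitName S)) (F : Set S.AnyVar), K.Finite ∧ F.Finite ∧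
    ∀ ρ : Naming S, Set.InjOn ρ.toVar K → (∀ n ∈ K, ρ.toVar n ∉ F) → ρ ∈ U}
  univ_sets := ⟨∅, ∅, Set.finite_empty, Set.finite_empty, fun _ _ _ => trivial⟩
  sets_of_superset := by
    rintro U U' ⟨K, F, hK, hF, h⟩ hU
    exact ⟨K, F, hK, hF, fun ρ h1 h2 => hU (h ρ h1 h2)⟩
  inter_sets := by
    rintro U U' ⟨K, F, hK, hF, h⟩ ⟨K', F', hK', hF', h'⟩
    exact ⟨K ∪ K', F ∪ F', hK.union hK', hF.union hF', fun ρ h1 h2 =>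
      ⟨h ρ (h1.mono Set.subset_union_left) fun n hn hx => h2 n (Or.inl hn) (Or.inl hx),
        h' ρ (h1.mono Set.subset_union_right) fun n hn hx => h2 n (Or.inr hn) (Or.inr hx)⟩⟩

theorem eventually_fresh_notMem {K : Set (WitName S)} {F : Set S.AnyVar} (hK : K.Finite)
    (hF : F.Finite) : ∀ᶠ ρ in fresh S, ∀ n ∈ K, ρ.toVar n ∉ F :=
  ⟨K, F, hK, hF, fun _ _ h => h⟩

theorem eventually_fresh_injOn {K : Set (WitName S)} (hK : K.Finite) :
    ∀ᶠ ρ in fresh S, Set.InjOn ρ.toVar K :=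
  ⟨K, ∅, hK, Set.finite_empty, fun _ h _ => h⟩

instance : (fresh S).NeBot := by
  classical
  refine ⟨fun h => ?_⟩
  obtain ⟨K, F, hK, hF, h⟩ := Filter.empty_mem_iff_bot.2 h
  obtain ⟨f, hf⟩ := Set.countable_iff_exists_injOn.1 hK.countable
  have e : ∀ s, S.Var s ≃ ℕ := fun s => Classical.choice (S.var_enumerable s)
  -- Number the witnesses in `K` injectively and shift the numbers beyond all variables in `F`.
  obtain ⟨N, hN⟩ : BddAbove _ := (hF.image fun x : S.AnyVar => e x.1 x.2).bddAbove
  let ρ : Naming S := fun n => (e n.1.1).symm (N + 1 + f n)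
  have hρ : ∀ n, e (ρ.toVar n).1 (ρ.toVar n).2 = N + 1 + f n :=
    fun n => (e n.1.1).apply_symm_apply _
  refine h ρ (fun n hn m hm hnm => hf hn hm ?_) fun n _ hx => ?_
  · have := hρ m
    rw [← hnm, hρ n] at this
    omega
  · have := hN ⟨_, hx, rfl⟩
    simp only [hρ] at this
    omega

end Fresh

/-! ### Henkin valuations -/

section Henkin

variable {S : Signature.{u}} {T : Set (Formula S)}

open HExpr

/-- A truth valuation of the enriched formulas that respects the propositional connectives. -/
structure IsHValuation (v : HFormula S → Prop) : Prop where
  verum : ∀ vs args, v (app .verum vs args)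
  falsum : ∀ vs args, ¬ v (app .falsum vs args)
  neg : ∀ vs args, v (app .neg vs args) ↔ ¬ v (args (0 : Fin 1))
  imp : ∀ vs args, v (app .imp vs args) ↔ (v (args (0 : Fin 2)) → v (args (1 : Fin 2)))
  and : ∀ vs args, v (app .and vs args) ↔ (v (args (0 : Fin 2)) ∧ v (args (1 : Fin 2)))
  or : ∀ vs args, v (app .or vs args) ↔ (v (args (0 : Fin 2)) ∨ v (args (1 : Fin 2)))
  iff : ∀ vs args, v (app (.eq S.prop) vs args) ↔
    (v (args (0 : Fin 2)) ↔ v (args (1 : Fin 2)))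

/-- A valuation that is the truth predicate of a structure in which every element of a sort with
quantifiers is denoted by a closed expression. -/
structure IsHenkin (v : HFormula S → Prop) : Prop extends IsHValuation v where
  all_iff : ∀ (x : S.AnyVar) (φ : HFormula S),
    v (all x φ) ↔ ∀ a : HExpr S x.1, a.Closed → v (φ.subst (single x a))
  ex_iff : ∀ (x : S.AnyVar) (φ : HFormula S),
    v (ex x φ) ↔ ∃ a : HExpr S x.1, a.Closed ∧ v (φ.subst (single x a))
  eq_refl : ∀ {α : S.Srt} (a : HExpr S α), v (a.eq a)
  eq_congr : ∀ (o : S.Sym) (i : Fin (S.sig o).arity)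
    (vs ws : (j : Fin (S.sig o).arity) →
      {v : S.VarSeq ((S.sig o).binders j) // (tlist v).Nodup})
    (a b : (j : Fin (S.sig o).arity) → HExpr S ((S.sig o).argSort j))
    (z : S.VarSeq ((S.sig o).binders i)),
    (∀ j, j ≠ i → vs j = ws j ∧ a j = b j) → (tlist z).Nodup →
    (∀ x ∈ tlist z, x ∉ (a i).fv ∪ (a i).bv ∪ ((b i).fv ∪ (b i).bv)) →
    v (allList (tlist z) (((a i).rename (vs i).1 z).eq ((b i).rename (ws i).1 z))) →
    v ((app o vs a).eq (app o ws b))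

/-- The axiom that makes `wit x φ` a counterexample to `∀ x φ` if there is one. -/
noncomputable def henkinAxiom (n : WitName S) : HFormula S :=
  (n.2.subst (single n.1 (wit n.1 n.2))).imp (all n.1 n.2)

theorem Expr.app_eq_app {o : S.Sym} {vs ws args args'}
    (hv : ∀ i, (vs i).1 = (ws i).1) (h : ∀ i, args i = args' i) :
    Expr.app o vs args = Expr.app o ws args' := by
  obtain rfl : vs = ws := funext fun i => Subtype.ext (hv i)
  obtain rfl : args = args' := funext h
  rfl

theorem IsValuation.comp_tr {w : Formula S → Prop} (hw : IsValuation w) (ρ : Naming S) :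
    IsHValuation fun φ => w (φ.tr ρ) where
  verum vs args := by
    have h : (app .verum vs args).tr ρ = Expr.verum := by
      rw [tr]
      exact Expr.app_eq_app (fun i => Fin.elim0 i) (fun i => Fin.elim0 i)
    rw [h]
    exact hw.verum
  falsum vs args := by
    have h : (app .falsum vs args).tr ρ = Expr.falsum := by
      rw [tr]
      exact Expr.app_eq_app (fun i => Fin.elim0 i) (fun i => Fin.elim0 i)
    rw [h]
    exact hw.falsum
  neg vs args := by
    rw [tr, ← hw.neg, Expr.neg]
    exact Iff.of_eq (congrArg w (Expr.app_eq_app (fun _ => rfl)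
      (Fin.forall_fin_one.2 rfl)))
  imp vs args := by
    rw [tr, ← hw.imp, Expr.imp]
    exact Iff.of_eq (congrArg w (Expr.app_eq_app (fun _ => rfl)
      (Fin.forall_fin_two.2 ⟨rfl, rfl⟩)))
  and vs args := by
    rw [tr, ← hw.and, Expr.and]
    exact Iff.of_eq (congrArg w (Expr.app_eq_app (fun _ => rfl)
      (Fin.forall_fin_two.2 ⟨rfl, rfl⟩)))
  or vs args := by
    rw [tr, ← hw.or, Expr.or]
    exact Iff.of_eq (congrArg w (Expr.app_eq_app (fun _ => rfl)
      (Fin.forall_fin_two.2 ⟨rfl, rfl⟩)))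
  iff vs args := by
    rw [tr, ← hw.iff, Expr.iff, Expr.eq]
    exact Iff.of_eq (congrArg w (Expr.app_eq_app (fun _ => rfl)
      (Fin.forall_fin_two.2 ⟨rfl, rfl⟩)))

theorem IsHValuation.imp' {v : HFormula S → Prop} (hv : IsHValuation v) (φ ψ : HFormula S) :
    v (φ.imp ψ) ↔ (v φ → v ψ) := hv.imp _ _

/-- Finitely many Henkin axioms are consistent with `T`. The axiom whose witness has the largest
rank is dropped first: its witness does not occur in the other axioms, so that the variable in its
place is fresh. -/
theorem not_eventually_denial (hT : Consistent T) (N : Finset (WitName S)) :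
    ¬ ∀ᶠ ρ in fresh S, Provable T (denial (N.toList.map fun n => (henkinAxiom n).tr ρ)) := by
  classical
  induction N using Finset.induction_on_max_value (fun n : WitName S => n.2.rank) with
  | empty =>
    intro h
    obtain ⟨ρ, hρ⟩ := h.exists
    rw [Finset.toList_empty] at hρ
    exact hT hρ
  | insert c N hc hmax ih =>
    intro h
    refine ih ?_
    -- All witnesses and all variables that occur in the axioms concerned.
    let K : Set (WitName S) := ⋃ n ∈ insert c N, insert n n.2.names
    let F : Set S.AnyVar := ⋃ n ∈ insert c N, insert n.1 ((n.2.fv ∪ n.2.bv) ∪ (henkinAxiom n).fv)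
    have hK : K.Finite := (insert c N).finite_toSet.biUnion
      fun n _ => (finite_names n.2).insert n
    have hF : F.Finite := (insert c N).finite_toSet.biUnion
      fun n _ => (((finite_fv n.2).union (finite_bv n.2)).union (finite_fv _)).insert n.1
    have hnames : ∀ n m : WitName S, m ∈ (henkinAxiom n).names → m = n ∨ m ∈ n.2.names := by
      intro n m hm
      rw [henkinAxiom, names_imp, names_all] at hm
      rcases hm with hm | hm
      · rcases mem_names_subst _ hm with hm | ⟨x, hx⟩
        · exact Or.inr hm
        · by_cases e : x = n.1
          · subst e
            rw [single_self, names] at hx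
            exact Or.inl hx
          · rw [single_of_ne e, names] at hx
            exact hx.elim
      · exact Or.inr hm
    have hmemK : ∀ n ∈ insert c N, ∀ m ∈ insert n n.2.names, m ∈ K := fun n hn m hm =>
      Set.mem_biUnion hn hm
    have hcK : c ∈ K := hmemK c (Finset.mem_insert_self _ _) c (Set.mem_insert _ _)
    filter_upwards [h, eventually_fresh_notMem hK hF, eventually_fresh_injOn hK]
      with ρ h hKF hinj
    have hcF := hKF c hcK
    have hcfv : ρ.toVar c ∉ c.2.fv := fun hx => hcF <|
      Set.mem_biUnion (Finset.mem_insert_self c N) (Or.inr (Or.inl (Or.inl hx)))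
    have hcbv : ρ.toVar c ∉ c.2.bv := fun hx => hcF <|
      Set.mem_biUnion (Finset.mem_insert_self c N) (Or.inr (Or.inl (Or.inr hx)))
    have hcc : c ∉ c.2.names := fun hx => lt_irrefl _ (rank_lt_of_mem_names _ hx)
    refine Provable.of_witness (x := c.1) (φ := c.2.tr ρ) (y := ρ c) ?_ ?_ ?_ ?_
    · intro hx
      rcases mem_fv_tr ρ _ hx with hx | ⟨n, hn, hx⟩
      · exact hcfv hx
      · have e := hinj hcK (hmemK c (Finset.mem_insert_self _ _) n (Set.mem_insert_of_mem _ hn)) hx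
        exact hcc (e.symm ▸ hn)
    · rw [bv_tr]
      exact hcbv
    · intro hx
      obtain ⟨ψ, hψ, hx⟩ := fv_denial hx
      obtain ⟨n, hn, rfl⟩ := List.mem_map.1 hψ
      have hn := Finset.mem_toList.1 hn
      rcases mem_fv_tr ρ _ hx with hx | ⟨m, hm, hx⟩
      · exact hcF (Set.mem_biUnion (Finset.mem_insert_of_mem hn) (Or.inr (Or.inr hx)))
      · have hm := hnames n m hm
        have e := hinj hcK (hmemK n (Finset.mem_insert_of_mem hn) m
          (hm.imp id id)) hx
        subst e
        rcases hm with rfl | hm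
        · exact hc hn
        · exact (rank_lt_of_mem_names _ hm).not_ge (hmax n hn)
    · have e : (henkinAxiom c).tr ρ = ((c.2.tr ρ).subst
          (Expr.single c.1 (.var ⟨c.1.1, ρ c⟩))).imp (.all c.1 (c.2.tr ρ)) := by
        rw [henkinAxiom, tr_imp, tr_all, tr_subst_single, tr]
        intro n hn hx
        exact hKF n (hmemK c (Finset.mem_insert_self _ _) n (Set.mem_insert_of_mem _ hn))
          (Set.mem_biUnion (Finset.mem_insert_self c N) (Or.inl hx))
      rw [← e]
      refine .of_forall_valuation [_] (by simpa using h) fun w hw => ?_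
      simp only [List.forall_mem_singleton, hw.imp, hw.denial_iff, List.mem_map,
        Finset.mem_toList, Finset.mem_insert]
      rintro ⟨_, ⟨n, rfl | hn, rfl⟩, hx⟩ h
      · exact (hx h).elim
      · exact ⟨_, ⟨n, hn, rfl⟩, hx⟩

/-- Finitely many requirements, each of which is an enriched formula that is eventually provable
from `T` or a Henkin axiom, can be met by one valuation. -/
theorem exists_valuation (hT : Consistent T) (L : Finset (HFormula S)) (N : Finset (WitName S)) :
    ∃ v : HFormula S → Prop, IsHValuation v ∧
      (∀ φ ∈ L, (∀ᶠ ρ in fresh S, Provable T (φ.tr ρ)) → v φ) ∧ ∀ n ∈ N, v (henkinAxiom n) := by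
  classical
  by_contra hcon
  refine not_eventually_denial hT N ?_
  have hL : ∀ᶠ ρ in fresh S, ∀ φ ∈ L.filter fun φ => ∀ᶠ ρ in fresh S, Provable T (φ.tr ρ),
      Provable T (φ.tr ρ) :=
    (Filter.eventually_all_finset _).2 fun φ hφ => (Finset.mem_filter.1 hφ).2
  filter_upwards [hL] with ρ hρ
  refine .of_forall_valuation ((L.filter fun φ => ∀ᶠ ρ in fresh S, Provable T (φ.tr ρ)).toList.map
    fun φ => φ.tr ρ) ?_ fun w hw hwL => ?_
  · intro ψ hψ
    obtain ⟨φ, hφ, rfl⟩ := List.mem_map.1 hψ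
    exact hρ φ (Finset.mem_toList.1 hφ)
  · rw [hw.denial_iff]
    by_contra hN
    refine hcon ⟨_, hw.comp_tr ρ, fun φ hφ h => hwL _ (List.mem_map.2 ⟨φ, ?_, rfl⟩),
      fun n hn => by_contra fun h => hN ⟨_, List.mem_map.2 ⟨n, Finset.mem_toList.2 hn, rfl⟩, h⟩⟩
    exact Finset.mem_toList.2 (Finset.mem_filter.2 ⟨hφ, h⟩)

/-- The limit along an ultrafilter of the valuations for finitely many requirements. -/
theorem exists_hValuation (hT : Consistent T) :
    ∃ v : HFormula S → Prop, IsHValuation v ∧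
      (∀ φ, (∀ᶠ ρ in fresh S, Provable T (φ.tr ρ)) → v φ) ∧ ∀ n, v (henkinAxiom n) := by
  classical
  choose v hv hP hH using exists_valuation (S := S) hT
  let U : Ultrafilter (Finset (HFormula S) × Finset (WitName S)) := .of Filter.atTop
  have hU : (U : Filter (Finset (HFormula S) × Finset (WitName S))) ≤ Filter.atTop :=
    Ultrafilter.of_le _
  refine ⟨fun φ => ∀ᶠ p in (U : Filter (Finset (HFormula S) × Finset (WitName S))),
    v p.1 p.2 φ, ?_, fun φ hφ => ?_, fun n => ?_⟩
  · constructor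
    · exact fun vs args => .of_forall fun p => (hv p.1 p.2).verum _ _
    · exact fun vs args h => h.exists.elim fun p => (hv p.1 p.2).falsum _ _
    · intro vs args
      simp only [(hv _ _).neg, Ultrafilter.eventually_not]
    · intro vs args
      simp only [(hv _ _).imp, Ultrafilter.eventually_imp]
    · intro vs args
      simp only [(hv _ _).and, Filter.eventually_and]
    · intro vs args
      simp only [(hv _ _).or, Ultrafilter.eventually_or]
    · intro vs args
      simp only [(hv _ _).iff, iff_iff_implies_and_implies, Filter.eventually_and,
        Ultrafilter.eventually_imp]
  · filter_upwards [hU (Filter.eventually_ge_atTop ({φ}, ∅))] with p hp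
    exact hP p.1 p.2 φ (hp.1 (Finset.mem_singleton_self φ)) hφ
  · filter_upwards [hU (Filter.eventually_ge_atTop (∅, {n}))] with p hp
    exact hH p.1 p.2 n (hp.2 (Finset.mem_singleton_self n))

/-- For a fresh naming, the expression put in place of a closed expression is substitutable, and the
substitution commutes with the naming. -/
theorem eventually_substitutable (x : S.AnyVar) (φ : HFormula S) {a : HExpr S x.1}
    (ha : a.Closed) : ∀ᶠ ρ in fresh S, (a.tr ρ).Substitutable x (φ.tr ρ) ∧
      (φ.subst (single x a)).tr ρ = (φ.tr ρ).subst (Expr.single x (a.tr ρ)) := by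
  filter_upwards [eventually_fresh_notMem (finite_names a) (finite_bv φ),
    eventually_fresh_notMem (finite_names φ) (Set.finite_singleton x)] with ρ h1 h2
  refine ⟨Expr.substitutable_of_disjoint _ _ _ fun y hy => ?_, tr_subst_single ρ φ x a h2⟩
  rw [bv_tr]
  rcases mem_fv_tr ρ a hy with hy | ⟨n, hn, rfl⟩
  · rw [Closed] at ha
    rw [ha] at hy
    exact hy.elim
  · exact h1 n hn

theorem eventually_eq_congr (o : S.Sym) (i : Fin (S.sig o).arity)
    (vs ws : (j : Fin (S.sig o).arity) →
      {v : S.VarSeq ((S.sig o).binders j) // (tlist v).Nodup})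
    (a b : (j : Fin (S.sig o).arity) → HExpr S ((S.sig o).argSort j))
    (z : S.VarSeq ((S.sig o).binders i))
    (hj : ∀ j, j ≠ i → vs j = ws j ∧ a j = b j) (hz : (tlist z).Nodup)
    (hf : ∀ x ∈ tlist z, x ∉ (a i).fv ∪ (a i).bv ∪ ((b i).fv ∪ (b i).bv)) :
    ∀ᶠ ρ in fresh S, Provable T
      (((allList (tlist z) (((a i).rename (vs i).1 z).eq ((b i).rename (ws i).1 z))).imp
        ((app o vs a).eq (app o ws b))).tr ρ) := by
  filter_upwards [eventually_fresh_notMem ((finite_names (a i)).union (finite_names (b i)))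
    (((tlist (vs i).1).finite_toSet.union (tlist (ws i).1).finite_toSet).union
      (tlist z).finite_toSet)] with ρ h
  rw [tr_imp, tr_allList, tr_eq, tr_eq, tr, tr,
    tr_rename ρ _ _ _ fun n hn hx => h n (Or.inl hn) (Or.inl (Or.inl hx)),
    tr_rename ρ _ _ _ fun n hn hx => h n (Or.inr hn) (Or.inl (Or.inr hx))]
  refine .logical _ (.eq_congr o i vs ws (fun j => (a j).tr ρ) (fun j => (b j).tr ρ) z
    (fun j hji => ⟨(hj j hji).1, by rw [(hj j hji).2]⟩) hz fun x hx => ?_)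
  rw [bv_tr, bv_tr]
  have hfx := hf x hx
  simp only [Set.mem_union, not_or] at hfx ⊢
  refine ⟨⟨fun hx' => ?_, hfx.1.2⟩, fun hx' => ?_, hfx.2.2⟩
  · rcases mem_fv_tr ρ _ hx' with hx' | ⟨n, hn, rfl⟩
    · exact hfx.1.1 hx'
    · exact h n (Or.inl hn) (Or.inr hx)
  · rcases mem_fv_tr ρ _ hx' with hx' | ⟨n, hn, rfl⟩
    · exact hfx.2.1 hx'
    · exact h n (Or.inr hn) (Or.inr hx)

/-- A consistent theory holds under some Henkin valuation. -/
theorem exists_isHenkin (hT : Consistent T) :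
    ∃ v : HFormula S → Prop, IsHenkin v ∧ ∀ φ ∈ T, ∀ l, v (allList l (emb φ)) := by
  obtain ⟨v, hv, hP, hH⟩ := exists_hValuation hT
  have inst : ∀ (x : S.AnyVar) (φ : HFormula S) (a : HExpr S x.1), a.Closed →
      v (all x φ) → v (φ.subst (single x a)) := by
    intro x φ a ha
    refine (hv.imp' _ _).1 (hP _ ?_)
    filter_upwards [eventually_substitutable x φ ha] with ρ h
    rw [tr_imp, tr_all, h.2]
    exact .logical _ (.all_inst x _ _ h.1)
  have gen : ∀ (x : S.AnyVar) (φ : HFormula S),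
      (∀ a : HExpr S x.1, a.Closed → v (φ.subst (single x a))) → v (all x φ) := fun x φ h =>
    (hv.imp' _ _).1 (hH (x, φ)) (h _ (closed_wit x φ))
  refine ⟨v, { hv with
    all_iff := fun x φ => ⟨fun h a ha => inst x φ a ha h, gen x φ⟩
    ex_iff := fun x φ => ⟨fun h => ?_, ?_⟩
    eq_refl := fun a => hP _ (.of_forall fun ρ => ?_)
    eq_congr := fun o i vs ws a b z hj hz hf =>
      (hv.imp' _ _).1 (hP _ (eventually_eq_congr o i vs ws a b z hj hz hf)) }, ?_⟩
  · -- If no closed instance of `φ` is true, then `∀ x (φ → ⊥)` is true, which refutes `∃ x φ`.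
    by_contra hcon
    have h1 : v (all x (φ.imp falsum)) := by
      refine gen x _ fun a ha => ?_
      rw [imp, subst, hv.imp]
      intro h'
      refine (hcon ⟨a, ha, ?_⟩).elim
      change v (φ.subst (mask [] (single x a))) at h'
      rwa [mask_nil] at h'
    have h2 : v ((all x (φ.imp falsum)).imp ((ex x φ).imp falsum)) := by
      refine hP _ (.of_forall fun ρ => ?_)
      simp only [tr_imp, tr_all, tr_ex, tr_falsum]
      exact .logical _ (.ex_imp x _ _ (by rw [Expr.fv_falsum]; exact Set.notMem_empty x))
    exact hv.falsum _ _ ((hv.imp' _ _).1 ((hv.imp' _ _).1 h2 h1) h)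
  · rintro ⟨a, ha, h⟩
    refine (hv.imp' _ _).1 (hP _ ?_) h
    filter_upwards [eventually_substitutable x φ ha] with ρ h
    rw [tr_imp, tr_ex, h.2]
    exact .logical _ (.ex_intro x _ _ h.1)
  · rw [tr_eq]
    exact .logical _ (.eq_refl _)
  · intro φ hφ l
    refine hP _ (.of_forall fun ρ => ?_)
    rw [tr_allList, tr_emb]
    exact (Provable.ax φ hφ).allList l

end Henkin

/-! ### Closed assignments -/

namespace HExpr

variable {S : Signature.{u}}

def verum : HFormula S := app .verum (fun i => i.elim0) (fun i => i.elim0)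

theorem closed_verum : (verum : HFormula S).Closed := by
  rw [verum, Closed, fv]
  exact Set.iUnion_eq_empty.2 fun i => i.elim0

open Classical in
/-- The assignment that agrees with `η` on the list `l` and with `θ` elsewhere. -/
noncomputable def patch (l : List S.AnyVar) (η θ : (x : S.AnyVar) → HExpr S x.1) (x : S.AnyVar) :
    HExpr S x.1 :=
  if x ∈ l then η x else θ x

theorem patch_of_mem {l : List S.AnyVar} {x : S.AnyVar} (h : x ∈ l)
    (η θ : (x : S.AnyVar) → HExpr S x.1) : patch l η θ x = η x := if_pos h

theorem patch_of_notMem {l : List S.AnyVar} {x : S.AnyVar} (h : x ∉ l)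
    (η θ : (x : S.AnyVar) → HExpr S x.1) : patch l η θ x = θ x := if_neg h

/-- An assignment of closed expressions. -/
def ClosedEnv (θ : (x : S.AnyVar) → HExpr S x.1) : Prop := ∀ x, (θ x).Closed

theorem ClosedEnv.patch {η θ : (x : S.AnyVar) → HExpr S x.1} {l : List S.AnyVar}
    (hη : ∀ x ∈ l, (η x).Closed) (hθ : ClosedEnv θ) : ClosedEnv (patch l η θ) := fun x => by
  by_cases h : x ∈ l
  · rw [patch_of_mem h]
    exact hη x h
  · rw [patch_of_notMem h]
    exact hθ x

/-- Some assignment of closed expressions. -/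
def closing (x : S.AnyVar) : HExpr S x.1 := wit x falsum

theorem closedEnv_closing : ClosedEnv (closing (S := S)) := fun _ => closed_wit _ _

theorem Closed.notMem {γ : S.Srt} {e : HExpr S γ} (h : e.Closed) (x : S.AnyVar) : x ∉ e.fv := by
  rw [Closed] at h
  rw [h]
  exact Set.notMem_empty x

theorem subst_mask_subst {γ : S.Srt} (e : HExpr S γ) (l : List S.AnyVar)
    {θ : (x : S.AnyVar) → HExpr S x.1} (hθ : ClosedEnv θ) (η : (x : S.AnyVar) → HExpr S x.1) :
    (e.subst (mask l θ)).subst η = e.subst (patch l η θ) := by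
  rw [subst_subst]
  · refine subst_congr _ fun x _ => ?_
    by_cases h : x ∈ l
    · rw [mask_of_mem h, patch_of_mem h, subst]
    · rw [mask_of_notMem h, patch_of_notMem h, (hθ x).subst_eq]
  · intro x y hy
    by_cases h : x ∈ l
    · rw [mask_of_mem h, fv] at hy
      exact Or.inl hy
    · rw [mask_of_notMem h] at hy
      exact ((hθ x).notMem y hy).elim

theorem mem_of_mem_fv_subst_mask {γ : S.Srt} (e : HExpr S γ) {l : List S.AnyVar}
    {θ : (x : S.AnyVar) → HExpr S x.1} (hθ : ClosedEnv θ) {x : S.AnyVar}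
    (hx : x ∈ (e.subst (mask l θ)).fv) : x ∈ l := by
  obtain ⟨y, -, hy⟩ := exists_of_mem_fv_subst e hx
  by_cases h : y ∈ l
  · rw [mask_of_mem h, fv] at hy
    obtain rfl := Set.mem_singleton_iff.1 hy
    exact h
  · rw [mask_of_notMem h] at hy
    exact ((hθ y).notMem x hy).elim

theorem mem_of_mem_fv_rename {γ : S.Srt} {e : HExpr S γ} {σ : List S.VSrt} {w : S.VarSeq σ}
    (he : ∀ x ∈ e.fv, x ∈ tlist w) (z : S.VarSeq σ) {x : S.AnyVar}
    (hx : x ∈ (e.rename w z).fv) : x ∈ tlist z := by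
  obtain ⟨y, hy, hxy⟩ := exists_of_mem_fv_subst e hx
  obtain ⟨t, ht, h⟩ := Expr.exists_varRename_eq_var w z y
  rw [ht, emb, fv] at hxy
  obtain rfl := Set.mem_singleton_iff.1 hxy
  exact h.resolve_left fun h => h.2 (he y hy)

theorem emb_varRename_subst {σ : List S.VSrt} (w z : S.VarSeq σ)
    (η : (x : S.AnyVar) → HExpr S x.1) (x : S.AnyVar) :
    (emb (Expr.varRename w z x)).subst η =
      override (D := fun s : S.VSrt => HExpr S s) η w (tmapv η z) x := by
  rw [Expr.varRename, Expr.seqSubst_eq_override, Expr.varSeq_eq_tmapv]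
  refine (map_override_tmapv (D := fun s : S.VSrt => Expr S s)
    (E := fun s : S.VSrt => HExpr S s) (fun _ e => (emb e).subst η) _ _ w z x).trans ?_
  simp only [emb, subst]

theorem subst_eq {α : S.Srt} (a b : HExpr S α) (θ : (x : S.AnyVar) → HExpr S x.1) :
    (a.eq b).subst θ = (a.subst θ).eq (b.subst θ) := by
  have h : ∀ c : HExpr S α, c.subst (mask [] θ) = c.subst θ := fun c => by rw [mask_nil]
  rw [eq, subst, eq]
  congr 1
  funext i
  revert i
  exact Fin.forall_fin_two.2 ⟨h a, h b⟩

theorem rename_nil {γ : S.Srt} (e : HExpr S γ) (w z : S.VarSeq []) : e.rename w z = e := by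
  refine (subst_congr e fun x _ => ?_).trans (subst_var e)
  rw [Expr.varRename_of_notMem w z (List.not_mem_nil (a := x)), emb]

theorem app_eq_app {o : S.Sym} {vs ws args args'}
    (hv : ∀ i, (vs i).1 = (ws i).1) (h : ∀ i, args i = args' i) :
    app o vs args = app o ws args' := by
  obtain rfl : vs = ws := funext fun i => Subtype.ext (hv i)
  obtain rfl : args = args' := funext h
  rfl

theorem closed_of_forall_mem_nil {γ : S.Srt} {e : HExpr S γ} {w : S.VarSeq []}
    (h : ∀ x ∈ e.fv, x ∈ tlist w) : e.Closed :=
  Set.eq_empty_of_forall_notMem fun x hx => List.not_mem_nil (h x hx)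

end HExpr

/-! ### Equality and quantifiers under a Henkin valuation -/

section Model

open HExpr

variable {S : Signature.{u}} {v : HFormula S → Prop}

namespace IsHenkin

theorem eq_left (hv : IsHenkin v) {α : S.Srt} {a b : HExpr S α} (c : HExpr S α) (h : v (a.eq b)) :
    v (a.eq c) ↔ v (b.eq c) := by
  refine (hv.iff _ _).1 (hv.eq_congr (.eq α) (0 : Fin 2) (fun _ => ⟨PUnit.unit, List.nodup_nil⟩)
    (fun _ => ⟨PUnit.unit, List.nodup_nil⟩) ![a, c] ![b, c] PUnit.unit ?_ List.nodup_nil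
    (fun _ h => absurd h List.not_mem_nil) ?_)
  · intro j hj
    refine ⟨rfl, ?_⟩
    revert j
    exact Fin.forall_fin_two.2 ⟨fun h => absurd rfl h, fun _ => rfl⟩
  · have h' : ∀ w z : S.VarSeq [], v ((a.rename w z).eq (b.rename w z)) := fun w z => by
      rwa [rename_nil, rename_nil]
    exact h' _ _

theorem eq_trans (hv : IsHenkin v) {α : S.Srt} {a b c : HExpr S α} (h : v (a.eq b))
    (h' : v (b.eq c)) : v (a.eq c) :=
  (hv.eq_left c h).2 h'

/-- A block of universal quantifiers is evaluated by running through all closed instances. -/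
theorem allList_subst_iff (hv : IsHenkin v) (ψ : HFormula S) : ∀ (l : List S.AnyVar)
    (θ : (x : S.AnyVar) → HExpr S x.1), (∀ x, (θ x).Closed ∨ θ x = var x) →
    (v ((allList l ψ).subst θ) ↔ ∀ η : (x : S.AnyVar) → HExpr S x.1,
      (∀ x ∈ l, (η x).Closed) → (∀ x, x ∉ l → η x = θ x) → v (ψ.subst η))
  | [], θ, _ => by
      refine ⟨fun h η _ hη => ?_, fun h => h θ (fun _ h => absurd h List.not_mem_nil)
        fun _ _ => rfl⟩
      rwa [show η = θ from funext fun x => hη x List.not_mem_nil]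
  | z :: l, θ, hθ => by
      classical
      have e : (allList (z :: l) ψ).subst θ = all z ((allList l ψ).subst (mask [z] θ)) := by
        rw [allList, all, subst]
        rfl
      have e' : ∀ a : HExpr S z.1, ((allList l ψ).subst (mask [z] θ)).subst (single z a) =
          (allList l ψ).subst (Function.update θ z a) := by
        intro a
        rw [subst_subst]
        · refine subst_congr _ fun x _ => ?_
          by_cases hx : x = z
          · subst hx
            rw [mask_of_mem (List.mem_singleton_self x), subst, single_self, Function.update_self]
          · rw [mask_of_notMem (by simpa using hx), Function.update_of_ne hx]
            rcases hθ x with h | h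
            · exact h.subst_eq _
            · rw [h, subst, single_of_ne hx]
        · intro x y hy
          by_cases hx : x = z
          · subst hx
            rw [mask_of_mem (List.mem_singleton_self x), fv] at hy
            exact Or.inl hy
          · rw [mask_of_notMem (by simpa using hx)] at hy
            rcases hθ x with h | h
            · exact (h.notMem y hy).elim
            · rw [h, fv] at hy
              exact Or.inl hy
      have hθ' : ∀ a : HExpr S z.1, a.Closed → ∀ x, (Function.update θ z a x).Closed ∨
          Function.update θ z a x = var x := by
        intro a ha x
        by_cases hx : x = z
        · subst hx
          rw [Function.update_self]
          exact Or.inl ha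
        · rw [Function.update_of_ne hx]
          exact hθ x
      rw [e, hv.all_iff]
      constructor
      · intro h η hη hηθ
        have hz := hη z List.mem_cons_self
        have h1 := h (η z) hz
        rw [e', hv.allList_subst_iff ψ l _ (hθ' _ hz)] at h1
        refine h1 η (fun x hx => hη x (List.mem_cons_of_mem _ hx)) fun x hx => ?_
        by_cases hxz : x = z
        · subst hxz
          rw [Function.update_self]
        · rw [Function.update_of_ne hxz]
          exact hηθ x (by simpa [hxz] using hx)
      · intro h a ha
        rw [e', hv.allList_subst_iff ψ l _ (hθ' _ ha)]
        intro η hη hηθ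
        refine h η (fun x hx => ?_) fun x hx => ?_
        · by_cases hxl : x ∈ l
          · exact hη x hxl
          · obtain rfl := (List.mem_cons.1 hx).resolve_right hxl
            rw [hηθ x hxl, Function.update_self]
            exact ha
        · have hx' : x ≠ z ∧ x ∉ l := by simpa using hx
          rw [hηθ x hx'.2, Function.update_of_ne hx'.1]

theorem subst_of_allList (hv : IsHenkin v) {ψ : HFormula S} (h : ∀ l, v (allList l ψ))
    {θ : (x : S.AnyVar) → HExpr S x.1} (hθ : ClosedEnv θ) : v (ψ.subst θ) := by
  have h1 := h ψ.finite_fv.toFinset.toList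
  rw [← subst_var (allList _ ψ), hv.allList_subst_iff ψ _ var fun _ => Or.inr rfl] at h1
  have h2 := h1 (patch ψ.finite_fv.toFinset.toList θ var)
    (fun x hx => by rw [patch_of_mem hx]; exact hθ x) fun x hx => patch_of_notMem hx _ _
  rwa [subst_congr ψ fun x hx => patch_of_mem (by simpa using hx) θ var] at h2

theorem allList_of_subst (hv : IsHenkin v) {ψ : HFormula S} {l : List S.AnyVar}
    (hl : ∀ x ∈ ψ.fv, x ∈ l) (h : ∀ θ, ClosedEnv θ → v (ψ.subst θ)) : v (allList l ψ) := by
  rw [← subst_var (allList _ ψ), hv.allList_subst_iff ψ _ var fun _ => Or.inr rfl]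
  intro η hη _
  have h1 := h (patch l η closing) (.patch hη closedEnv_closing)
  rwa [subst_congr ψ fun x hx => patch_of_mem (hl x hx) η closing] at h1

end IsHenkin

/-! ### The term model -/

/-- The range of the sort `α` in the term model: the classes of closed expressions modulo the
equality given by `v`. A sort without expressions gets one element, the empty class. -/
def Carrier (v : HFormula S → Prop) (α : S.Srt) : Type u :=
  {X : Set (HExpr S α) // Nonempty (HExpr S α) → ∃ a : HExpr S α, a.Closed ∧ X = {b | v (a.eq b)}}

/-- The value of an expression in the term model; free variables are evaluated by `closing`. -/
def val (v : HFormula S → Prop) {α : S.Srt} (e : HExpr S α) : Carrier v α :=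
  ⟨{b | v ((e.subst closing).eq b)},
    fun _ => ⟨e.subst closing, closed_subst e closedEnv_closing, rfl⟩⟩

instance (v : HFormula S → Prop) (α : S.Srt) : Nonempty (Carrier v α) := by
  by_cases h : Nonempty (HExpr S α)
  · exact h.map (val v)
  · exact ⟨⟨∅, fun h' => absurd h' h⟩⟩

theorem Carrier.eq_of_not_nonempty {α : S.Srt} (h : ¬ Nonempty (HExpr S α)) (x y : Carrier v α) :
    x = y := by
  refine Subtype.ext (Set.ext fun a => ?_)
  exact absurd ⟨a⟩ h

theorem val_subst_closing {α : S.Srt} (e : HExpr S α) : val v (e.subst closing) = val v e := by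
  rw [val, val]
  congr 2
  rw [(closed_subst e closedEnv_closing).subst_eq]

theorem coe_val {α : S.Srt} {a : HExpr S α} (ha : a.Closed) : (val v a).1 = {b | v (a.eq b)} := by
  change {b | v ((a.subst closing).eq b)} = _
  rw [ha.subst_eq]

theorem val_eq_val_iff (hv : IsHenkin v) {α : S.Srt} {a b : HExpr S α} (ha : a.Closed)
    (hb : b.Closed) : val v a = val v b ↔ v (a.eq b) := by
  constructor
  · intro h
    have h' := congrArg Subtype.val h
    rw [coe_val ha, coe_val hb] at h'
    exact h'.ge (hv.eq_refl b)
  · intro h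
    refine Subtype.ext ?_
    rw [coe_val ha, coe_val hb]
    exact Set.ext fun c => hv.eq_left c h

theorem exists_val_eq {α : S.Srt} (h : Nonempty (HExpr S α)) (x : Carrier v α) :
    ∃ a : HExpr S α, a.Closed ∧ val v a = x := by
  obtain ⟨a, ha, hx⟩ := x.2 h
  exact ⟨a, ha, Subtype.ext ((coe_val ha).trans hx.symm)⟩

/-- Tuples of elements of the term model. -/
abbrev CTup (v : HFormula S → Prop) (σ : List S.VSrt) : Type u :=
  List.TProd (fun s : S.VSrt => Carrier v s) σ

/-- The values of the variables under an assignment. -/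
def valEnv (v : HFormula S → Prop) (θ : (x : S.AnyVar) → HExpr S x.1) (x : S.AnyVar) :
    Carrier v x.1 := val v (θ x)

/-- Every tuple of elements is the tuple of values of a given sequence of variables under a closed
assignment, up to repetitions of variables, where the rightmost position counts. -/
theorem exists_closedEnv {σ : List S.VSrt} (u : S.VarSeq σ) (x : CTup v σ) :
    ∃ θ : (x : S.AnyVar) → HExpr S x.1, ClosedEnv θ ∧
      override (D := fun s : S.VSrt => Carrier v s) (valEnv v θ) u x = valEnv v θ := by
  choose θ hθ h using fun y : S.AnyVar => exists_val_eq (v := v) ⟨closing y⟩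
    (override (D := fun s : S.VSrt => Carrier v s) (valEnv v closing) u x y)
  refine ⟨θ, hθ, funext fun y => ?_⟩
  by_cases hy : y ∈ tlist u
  · rw [override_congr u x (g' := valEnv v closing) fun h => absurd hy h]
    exact (h y).symm
  · rw [override_of_notMem _ _ _ hy]

theorem exists_closedEnv_tmapv {σ : List S.VSrt} {u : S.VarSeq σ} (hu : (tlist u).Nodup)
    (x : CTup v σ) : ∃ θ : (x : S.AnyVar) → HExpr S x.1, ClosedEnv θ ∧
      tmapv (D := fun s : S.VSrt => Carrier v s) (valEnv v θ) u = x := by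
  obtain ⟨θ, hθ, h⟩ := exists_closedEnv u x
  refine ⟨θ, hθ, ?_⟩
  rw [← h]
  exact tmapv_override _ _ _ hu

/-- The map `f` is described by the expression `e` as a function of the distinct variables `w`.
Further free variables of `e` are allowed, but their values do not matter. -/
def Represents (v : HFormula S → Prop) {γ : S.Srt} {σ : List S.VSrt}
    (f : CTup v σ → Carrier v γ) (w : S.VarSeq σ) (e : HExpr S γ) : Prop :=
  (tlist w).Nodup ∧ ∀ θ, ClosedEnv θ → f (tmapv (valEnv v θ) w) = val v (e.subst θ)

namespace Represents

variable {γ : S.Srt} {σ : List S.VSrt} {f : CTup v σ → Carrier v γ} {w : S.VarSeq σ}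
  {e : HExpr S γ}

/-- Fixing an initial part of the arguments. -/
theorem fix {ρ : List S.VSrt} {a : S.VarSeq σ} {b : S.VarSeq ρ} {g : CTup v (σ ++ ρ) → Carrier v γ}
    (h : Represents v g (tappend a b) e) {θ : (x : S.AnyVar) → HExpr S x.1} (hθ : ClosedEnv θ) :
    Represents v (fun r => g (tappend (tmapv (valEnv v θ) a) r)) b
      (e.subst (mask (tlist b) θ)) := by
  have hn := h.1
  rw [tlist_tappend, List.nodup_append] at hn
  refine ⟨hn.2.1, fun η hη => ?_⟩
  rw [subst_mask_subst _ _ hθ, ← h.2 _ (.patch (fun x _ => hη x) hθ), tmapv_tappend]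
  have ea : tmapv (D := fun s : S.VSrt => Carrier v s) (valEnv v (patch (tlist b) η θ)) a =
      tmapv (valEnv v θ) a :=
    tmapv_congr a fun y hy => by
      rw [valEnv, valEnv, patch_of_notMem fun hyb => hn.2.2 y hy y hyb rfl]
  have eb : tmapv (D := fun s : S.VSrt => Carrier v s) (valEnv v (patch (tlist b) η θ)) b =
      tmapv (valEnv v η) b :=
    tmapv_congr b fun y hy => by rw [valEnv, valEnv, patch_of_mem hy]
  rw [ea, eb]

theorem subst_mask (h : Represents v f w e) {θ : (x : S.AnyVar) → HExpr S x.1}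
    (hθ : ClosedEnv θ) : Represents v f w (e.subst (mask (tlist w) θ)) :=
  fix (σ := []) (a := PUnit.unit) h hθ

/-- The variables may be changed to fresh ones. -/
theorem rename (h : Represents v f w e) {z : S.VarSeq σ} (hz : (tlist z).Nodup)
    (hf : ∀ x ∈ tlist z, x ∉ e.bv) : Represents v f z (e.rename w z) := by
  refine ⟨hz, fun η hη => ?_⟩
  rw [HExpr.rename, subst_subst, ← h.2]
  · simp only [emb_varRename_subst]
    have e : valEnv v (override (D := fun s : S.VSrt => HExpr S s) η w (tmapv η z)) =
        override (D := fun s : S.VSrt => Carrier v s) (valEnv v η) w (tmapv (valEnv v η) z) :=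
      funext fun y => map_override_tmapv (D := fun s : S.VSrt => HExpr S s)
        (E := fun s : S.VSrt => Carrier v s) (fun _ e => val v e) η η w z y
    refine congrArg f (Eq.symm ?_)
    refine Eq.trans ?_ (tmapv_override (valEnv v η) _ _ h.1)
    exact congrArg (fun g => tmapv g w) e
  · exact fun x => closed_subst _ hη
  · intro x y hy
    obtain ⟨t, ht, h'⟩ := Expr.exists_varRename_eq_var w z x
    rw [ht, emb, fv] at hy
    obtain rfl := Set.mem_singleton_iff.1 hy
    exact h'.imp And.left (hf _)

theorem apply_nil {f : CTup v [] → Carrier v γ} {w : S.VarSeq []} (h : Represents v f w e) :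
    f PUnit.unit = val v e :=
  (h.2 _ closedEnv_closing).trans (val_subst_closing e)

theorem apply_singleton {s : S.VSrt} {f : CTup v [s] → Carrier v γ} {w : S.VarSeq [s]}
    (h : Represents v f w e) (he : ∀ x ∈ e.fv, x ∈ tlist w) {a : HExpr S s} (ha : a.Closed) :
    f (val v a, PUnit.unit) = val v (e.subst (single ⟨s, w.1⟩ a)) ∧
      (e.subst (single ⟨s, w.1⟩ a)).Closed := by
  let x : S.AnyVar := ⟨s, w.1⟩
  have hθ : ClosedEnv (patch [x] (single x a) closing) := by
    refine .patch (fun y hy => ?_) closedEnv_closing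
    obtain rfl := List.mem_singleton.1 hy
    rw [single_self]
    exact ha
  have h1 := h.2 _ hθ
  have h2 : e.subst (single x a) = e.subst (patch [x] (single x a) closing) :=
    (subst_congr e fun y hy => patch_of_mem (he y hy) _ _).symm
  rw [← h2] at h1
  refine ⟨?_, h2 ▸ closed_subst e hθ⟩
  rw [← h1]
  refine congrArg f (Prod.ext ?_ rfl)
  change val v a = val v (patch [x] (single x a) closing x)
  rw [patch_of_mem (List.mem_singleton_self x), single_self]

end Represents

/-- Compound expressions are equal if their arguments describe the same functions. -/
theorem eq_app_of_represents (hv : IsHenkin v) {o : S.Sym}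
    {vs ws : (i : Fin (S.sig o).arity) →
      {v : S.VarSeq ((S.sig o).binders i) // (tlist v).Nodup}}
    {a b : (i : Fin (S.sig o).arity) → HExpr S ((S.sig o).argSort i)}
    (f : (i : Fin (S.sig o).arity) →
      CTup v ((S.sig o).binders i) → Carrier v ((S.sig o).argSort i))
    (ha : ∀ i, Represents v (f i) (vs i).1 (a i)) (hb : ∀ i, Represents v (f i) (ws i).1 (b i))
    (hfa : ∀ i, ∀ x ∈ (a i).fv, x ∈ tlist (vs i).1)
    (hfb : ∀ i, ∀ x ∈ (b i).fv, x ∈ tlist (ws i).1) :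
    v ((app o vs a).eq (app o ws b)) := by
  classical
  -- The arguments are exchanged one at a time.
  suffices h : ∀ s : Finset (Fin (S.sig o).arity), v ((app o vs a).eq
      (app o (fun i => if i ∈ s then ws i else vs i) fun i => if i ∈ s then b i else a i)) by
    simpa using h Finset.univ
  intro s
  induction s using Finset.induction_on with
  | empty => simpa using hv.eq_refl _
  | insert i s hi ih =>
    refine hv.eq_trans ih ?_
    obtain ⟨z, hz, hzf⟩ := exists_fresh_seq (((a i).finite_fv.union (a i).finite_bv).union
      ((b i).finite_fv.union (b i).finite_bv)) ((S.sig o).binders i)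
    refine hv.eq_congr o i _ _ _ _ z (fun j hj => by simp [hj]) hz (by simpa [hi] using hzf) ?_
    simp only [hi, if_false, Finset.mem_insert_self, if_true]
    have h1 := (ha i).rename hz fun x hx h => hzf x hx (Or.inl (Or.inr h))
    have h2 := (hb i).rename hz fun x hx h => hzf x hx (Or.inr (Or.inr h))
    refine hv.allList_of_subst (fun x hx => ?_) fun ζ hζ => ?_
    · rw [HExpr.eq, fv] at hx
      obtain ⟨j, hj, -⟩ := Set.mem_iUnion.1 hx
      have key : ∀ j : Fin 2, x ∈ (![(a i).rename (vs i).1 z, (b i).rename (ws i).1 z] j).fv →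
          x ∈ tlist z :=
        Fin.forall_fin_two.2 ⟨mem_of_mem_fv_rename (hfa i) z, mem_of_mem_fv_rename (hfb i) z⟩
      exact key j hj
    · rw [subst_eq, ← val_eq_val_iff hv (closed_subst _ hζ) (closed_subst _ hζ), ← h1.2 ζ hζ,
        ← h2.2 ζ hζ]

/-- The value of a compound expression depends only on the functions that its arguments describe. -/
theorem val_app_eq (hv : IsHenkin v) {o : S.Sym}
    {vs ws : (i : Fin (S.sig o).arity) →
      {v : S.VarSeq ((S.sig o).binders i) // (tlist v).Nodup}}
    {a b : (i : Fin (S.sig o).arity) → HExpr S ((S.sig o).argSort i)}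
    (f : (i : Fin (S.sig o).arity) →
      CTup v ((S.sig o).binders i) → Carrier v ((S.sig o).argSort i))
    (ha : ∀ i, Represents v (f i) (vs i).1 (a i)) (hb : ∀ i, Represents v (f i) (ws i).1 (b i))
    {θ η : (x : S.AnyVar) → HExpr S x.1} (hθ : ClosedEnv θ) (hη : ClosedEnv η) :
    val v ((app o vs a).subst θ) = val v ((app o ws b).subst η) := by
  rw [val_eq_val_iff hv (closed_subst _ hθ) (closed_subst _ hη), subst, subst]
  exact eq_app_of_represents hv f (fun i => (ha i).subst_mask hθ) (fun i => (hb i).subst_mask hη)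
    (fun i _ => mem_of_mem_fv_subst_mask (a i) hθ) (fun i _ => mem_of_mem_fv_subst_mask (b i) hη)

/-- The selected functions of the term model: the maps described by expressions, and all maps into
a sort without expressions. -/
def termFn (v : HFormula S → Prop) (γ : S.Srt) (σ : List S.VSrt) :
    Set (CTup v σ → Carrier v γ) :=
  {f | Nonempty (HExpr S γ) → ∃ w e, Represents v f w e}

open Classical in
/-- The value of an operation of the term model at arguments in a sort without expressions. The
value true is needed for the equality of such a sort, which has one element. -/
noncomputable def defaultValue (v : HFormula S → Prop) : (γ : S.Srt) → Carrier v γ :=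
  Function.update (fun _ => Classical.arbitrary _) S.prop (val v verum)

open Classical in
/-- The interpretation of the operations in the term model: the symbol is applied to expressions
that describe the arguments. -/
noncomputable def termInterp (v : HFormula S → Prop) (o : S.Sym)
    (h : (i : Fin (S.sig o).arity) → termFn v ((S.sig o).argSort i) ((S.sig o).binders i)) :
    Carrier v (S.sig o).res :=
  if H : ∀ i, Nonempty (HExpr S ((S.sig o).argSort i)) then
    val v ((app o (fun i => ⟨((h i).2 (H i)).choose, ((h i).2 (H i)).choose_spec.choose_spec.1⟩)
      fun i => ((h i).2 (H i)).choose_spec.choose).subst closing)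
  else defaultValue v _

theorem termInterp_eq (hv : IsHenkin v) {o : S.Sym}
    {h : (i : Fin (S.sig o).arity) → termFn v ((S.sig o).argSort i) ((S.sig o).binders i)}
    {vs : (i : Fin (S.sig o).arity) → {v : S.VarSeq ((S.sig o).binders i) // (tlist v).Nodup}}
    {a : (i : Fin (S.sig o).arity) → HExpr S ((S.sig o).argSort i)}
    (hr : ∀ i, Represents v (h i).1 (vs i).1 (a i)) {θ : (x : S.AnyVar) → HExpr S x.1}
    (hθ : ClosedEnv θ) : termInterp v o h = val v ((app o vs a).subst θ) := by
  have H : ∀ i, Nonempty (HExpr S ((S.sig o).argSort i)) := fun i => ⟨a i⟩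
  rw [termInterp, dif_pos H]
  exact val_app_eq hv (fun i => (h i).1)
    (fun i => ((h i).2 (H i)).choose_spec.choose_spec) hr closedEnv_closing hθ

/-- At arguments in sorts with expressions, an operation takes the value of a closed expression. -/
theorem exists_termInterp_eq (hv : IsHenkin v) {o : S.Sym}
    (h : (i : Fin (S.sig o).arity) → termFn v ((S.sig o).argSort i) ((S.sig o).binders i))
    (H : ∀ i, Nonempty (HExpr S ((S.sig o).argSort i))) :
    ∃ vs a, termInterp v o h = val v (app o vs a) ∧ (app o vs a).Closed ∧
      (∀ i, Represents v (h i).1 (vs i).1 (a i)) ∧ ∀ i, ∀ x ∈ (a i).fv, x ∈ tlist (vs i).1 := by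
  choose w e hr using fun i => (h i).2 (H i)
  have hc : ((app o (fun i => ⟨w i, (hr i).1⟩) e).subst closing).Closed :=
    closed_subst _ closedEnv_closing
  have hi := termInterp_eq hv (vs := fun i => ⟨w i, (hr i).1⟩) hr closedEnv_closing
  rw [subst] at hc hi
  exact ⟨_, _, hi, hc, fun i => (hr i).subst_mask closedEnv_closing,
    fun i _ => mem_of_mem_fv_subst_mask (e i) closedEnv_closing⟩

theorem val_eq_verum_iff (hv : IsHenkin v) {φ : HFormula S} (hφ : φ.Closed) :
    val v φ = val v verum ↔ v φ := by
  rw [val_eq_val_iff hv hφ closed_verum, HExpr.eq, hv.iff]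
  exact iff_true_right (hv.verum _ _)

theorem fn_nil_termFn (γ : S.Srt) : termFn v γ [] = Set.univ := by
  refine Set.eq_univ_of_forall fun f hne => ?_
  obtain ⟨a, ha, h⟩ := exists_val_eq hne (f PUnit.unit)
  refine ⟨PUnit.unit, a, List.nodup_nil, fun θ _ => ?_⟩
  rw [ha.subst_eq, h]
  rfl

theorem const_mem_termFn (γ : S.Srt) (σ : List S.VSrt) (c : Carrier v γ) :
    (fun _ => c) ∈ termFn v γ σ := by
  intro hne
  obtain ⟨a, ha, h⟩ := exists_val_eq hne c
  obtain ⟨w, hw, -⟩ := exists_fresh_seq (S := S) Set.finite_empty σ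
  exact ⟨w, a, hw, fun θ _ => by rw [ha.subst_eq, h]⟩

theorem proj_mem_termFn (σ : List S.VSrt) (j : Fin σ.length) :
    (fun x : CTup v σ => tget x j) ∈ termFn v (σ.get j) σ := by
  intro _
  obtain ⟨w, hw, -⟩ := exists_fresh_seq (S := S) Set.finite_empty σ
  refine ⟨w, var ⟨σ.get j, tget w j⟩, hw, fun θ _ => ?_⟩
  rw [subst]
  exact tget_tmapv _ _ _

theorem fix_mem_termFn {γ : S.Srt} {σ ρ : List S.VSrt} {g : CTup v (σ ++ ρ) → Carrier v γ}
    (hg : g ∈ termFn v γ (σ ++ ρ)) (x : CTup v σ) :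
    (fun r => g (tappend x r)) ∈ termFn v γ ρ := by
  intro hne
  obtain ⟨u, e, h⟩ := hg hne
  obtain ⟨a, b, rfl⟩ := exists_tappend u
  have hn := h.1
  rw [tlist_tappend, List.nodup_append] at hn
  obtain ⟨θ, hθ, rfl⟩ := exists_closedEnv_tmapv hn.1 x
  exact ⟨b, _, h.fix hθ⟩

/-- The describing expressions of the arguments are first given the same variables for the common
arguments and fresh variables for the others. -/
theorem comp_mem_termFn (hv : IsHenkin v) (o : S.Sym) (σ : List S.VSrt)
    (g : (i : Fin (S.sig o).arity) →
      CTup v (σ ++ (S.sig o).binders i) → Carrier v ((S.sig o).argSort i))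
    (hg : ∀ i, g i ∈ termFn v ((S.sig o).argSort i) (σ ++ (S.sig o).binders i)) :
    (fun y => termInterp v o fun i => ⟨fun z => g i (tappend y z), fix_mem_termFn (hg i) y⟩) ∈
      termFn v (S.sig o).res σ := by
  by_cases H : ∀ i, Nonempty (HExpr S ((S.sig o).argSort i))
  · intro _
    choose u e he using fun i => hg i (H i)
    obtain ⟨t, ht, htf⟩ := exists_fresh_seq (Set.finite_iUnion fun i => (e i).finite_bv) σ
    choose b hb hbf using fun i => exists_fresh_seq
      ((e i).finite_bv.union (tlist t).finite_toSet) ((S.sig o).binders i)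
    have hn : ∀ i, (tlist (tappend t (b i))).Nodup := fun i => by
      rw [tlist_tappend, List.nodup_append]
      refine ⟨ht, hb i, ?_⟩
      rintro x hx _ hy rfl
      exact hbf i x hy (Or.inr hx)
    have hr : ∀ i, Represents v (g i) (tappend t (b i)) ((e i).rename (u i) (tappend t (b i))) :=
      fun i => (he i).rename (hn i) fun x hx hxe => by
        rw [tlist_tappend, List.mem_append] at hx
        rcases hx with hx | hx
        · exact htf x hx (Set.mem_iUnion.2 ⟨i, hxe⟩)
        · exact hbf i x hx (Or.inl hxe)
    refine ⟨t, app o (fun i => ⟨b i, hb i⟩) fun i => (e i).rename (u i) (tappend t (b i)), ht,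
      fun θ hθ => ?_⟩
    -- The closed instance is unchanged by a second substitution, as `termInterp_eq` requires.
    rw [← (closed_subst (app o _ _) hθ).subst_eq θ, subst]
    exact termInterp_eq hv (fun i => (hr i).fix hθ) hθ
  · have e : (fun y => termInterp v o fun i => ⟨fun z => g i (tappend y z),
        fix_mem_termFn (hg i) y⟩) = fun _ => defaultValue v _ :=
      funext fun y => by rw [termInterp, dif_neg H]
    rw [e]
    exact const_mem_termFn _ _ _

theorem apply_eq_verum_iff (hv : IsHenkin v) {f : CTup v [] → Carrier v S.prop} {w : S.VarSeq []}
    {φ : HFormula S} (h : Represents v f w φ) (hφ : ∀ x ∈ φ.fv, x ∈ tlist w) :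
    f PUnit.unit = val v verum ↔ v φ := by
  rw [h.apply_nil, val_eq_verum_iff hv (closed_of_forall_mem_nil hφ)]

theorem apply_singleton_eq_verum_iff (hv : IsHenkin v) {s : S.VSrt}
    {f : CTup v [s] → Carrier v S.prop} {w : S.VarSeq [s]} {φ : HFormula S}
    (h : Represents v f w φ) (hφ : ∀ x ∈ φ.fv, x ∈ tlist w) {a : HExpr S s} (ha : a.Closed) :
    f (val v a, PUnit.unit) = val v verum ↔ v (φ.subst (single ⟨s, w.1⟩ a)) := by
  have h' := h.apply_singleton hφ ha
  rw [h'.1, val_eq_verum_iff hv h'.2]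

/-- The term model of a Henkin valuation. -/
noncomputable def termModel (hv : IsHenkin v) : NormalStructure S where
  carrier := Carrier v
  carrier_nonempty _ := inferInstance
  fn := termFn v
  interp := termInterp v
  fn_nil := fn_nil_termFn
  fn_const := const_mem_termFn
  fn_proj := proj_mem_termFn
  fn_fix := fix_mem_termFn
  fn_comp := comp_mem_termFn hv
  tr := val v verum
  fa := val v falsum
  tr_ne_fa h := hv.falsum _ _ ((val_eq_verum_iff hv closed_falsum).1 h.symm)
  eq_tr_or_eq_fa p := by
    obtain ⟨φ, hφ, rfl⟩ := exists_val_eq ⟨falsum⟩ p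
    rw [val_eq_verum_iff hv hφ, val_eq_val_iff hv hφ closed_falsum, HExpr.eq, hv.iff]
    refine or_iff_not_imp_left.2 fun h => ?_
    exact iff_of_false h (hv.falsum _ _)
  interp_verum h := by
    obtain ⟨vs, a, e, hc, -⟩ := exists_termInterp_eq hv h fun i => Fin.elim0 i
    rw [e]
    exact (val_eq_verum_iff hv hc).2 (hv.verum _ _)
  interp_falsum h := by
    obtain ⟨vs, a, e, hc, -⟩ := exists_termInterp_eq hv h fun i => Fin.elim0 i
    rw [e]
    exact congrArg (val v) (app_eq_app (fun i => Fin.elim0 i) fun i => Fin.elim0 i)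
  interp_neg h := by
    obtain ⟨vs, a, e, hc, hr, hf⟩ := exists_termInterp_eq hv h fun _ => ⟨falsum⟩
    rw [e, apply_eq_verum_iff hv (hr (0 : Fin 1)) (hf (0 : Fin 1))]
    exact (val_eq_verum_iff hv hc).trans (hv.neg _ _)
  interp_imp h := by
    obtain ⟨vs, a, e, hc, hr, hf⟩ := exists_termInterp_eq hv h fun _ => ⟨falsum⟩
    rw [e, apply_eq_verum_iff hv (hr (0 : Fin 2)) (hf (0 : Fin 2)),
      apply_eq_verum_iff hv (hr (1 : Fin 2)) (hf (1 : Fin 2))]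
    exact (val_eq_verum_iff hv hc).trans (hv.imp _ _)
  interp_and h := by
    obtain ⟨vs, a, e, hc, hr, hf⟩ := exists_termInterp_eq hv h fun _ => ⟨falsum⟩
    rw [e, apply_eq_verum_iff hv (hr (0 : Fin 2)) (hf (0 : Fin 2)),
      apply_eq_verum_iff hv (hr (1 : Fin 2)) (hf (1 : Fin 2))]
    exact (val_eq_verum_iff hv hc).trans (hv.and _ _)
  interp_or h := by
    obtain ⟨vs, a, e, hc, hr, hf⟩ := exists_termInterp_eq hv h fun _ => ⟨falsum⟩
    rw [e, apply_eq_verum_iff hv (hr (0 : Fin 2)) (hf (0 : Fin 2)),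
      apply_eq_verum_iff hv (hr (1 : Fin 2)) (hf (1 : Fin 2))]
    exact (val_eq_verum_iff hv hc).trans (hv.or _ _)
  interp_all s h := by
    obtain ⟨vs, a, e, hc, hr, hf⟩ := exists_termInterp_eq hv h fun _ => ⟨falsum⟩
    have e' : app (.all s) vs a = all ⟨s, (vs (0 : Fin 1)).1.1⟩ (a (0 : Fin 1)) :=
      app_eq_app (Fin.forall_fin_one.2 rfl) (Fin.forall_fin_one.2 rfl)
    rw [e, (val_eq_verum_iff hv hc : _), e', hv.all_iff]
    constructor
    · intro hall x
      obtain ⟨b, hb, rfl⟩ := exists_val_eq ⟨wit ⟨s, (vs (0 : Fin 1)).1.1⟩ falsum⟩ x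
      exact (apply_singleton_eq_verum_iff hv (hr (0 : Fin 1)) (hf (0 : Fin 1)) hb).2 (hall b hb)
    · intro hall b hb
      exact (apply_singleton_eq_verum_iff hv (hr (0 : Fin 1)) (hf (0 : Fin 1)) hb).1 (hall _)
  interp_ex s h := by
    obtain ⟨vs, a, e, hc, hr, hf⟩ := exists_termInterp_eq hv h fun _ => ⟨falsum⟩
    have e' : app (.ex s) vs a = ex ⟨s, (vs (0 : Fin 1)).1.1⟩ (a (0 : Fin 1)) :=
      app_eq_app (Fin.forall_fin_one.2 rfl) (Fin.forall_fin_one.2 rfl)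
    rw [e, (val_eq_verum_iff hv hc : _), e', hv.ex_iff]
    constructor
    · rintro ⟨b, hb, h'⟩
      exact ⟨_, (apply_singleton_eq_verum_iff hv (hr (0 : Fin 1)) (hf (0 : Fin 1)) hb).2 h'⟩
    · rintro ⟨x, h'⟩
      obtain ⟨b, hb, rfl⟩ := exists_val_eq ⟨wit ⟨s, (vs (0 : Fin 1)).1.1⟩ falsum⟩ x
      exact ⟨b, hb, (apply_singleton_eq_verum_iff hv (hr (0 : Fin 1)) (hf (0 : Fin 1)) hb).1 h'⟩
  interp_eq α h := by
    by_cases H : Nonempty (HExpr S α)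
    · obtain ⟨vs, a, e, hc, hr, hf⟩ := exists_termInterp_eq hv h fun _ => H
      rw [e, (hr (0 : Fin 2)).apply_nil, (hr (1 : Fin 2)).apply_nil,
        val_eq_val_iff hv (closed_of_forall_mem_nil (hf (0 : Fin 2)))
          (closed_of_forall_mem_nil (hf (1 : Fin 2)))]
      refine (val_eq_verum_iff hv hc).trans (iff_of_eq (congrArg v ?_))
      exact app_eq_app (fun _ => rfl) (Fin.forall_fin_two.2 ⟨rfl, rfl⟩)
    · refine iff_of_true ?_ (Carrier.eq_of_not_nonempty H _ _)
      rw [termInterp, dif_neg fun h => H (h (0 : Fin 2)), defaultValue]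
      classical exact Function.update_self _ _ _

/-! ### Truth in the term model -/

theorem lookup_eq_override (M : NormalStructure S) : ∀ {σ : List S.VSrt} (u : S.VarSeq σ)
    (y : S.AnyVar) (h : y ∈ tlist u) (x : M.Tup σ) (g : (z : S.AnyVar) → M.carrier z.1),
    M.lookup u y h x = override (D := fun s : S.VSrt => M.carrier s) g u x y
  | [], _, _, h, _, _ => absurd h List.not_mem_nil
  | s :: _, u, y, h, x, g => by
      by_cases hy : y ∈ tlist u.2
      · rw [NormalStructure.lookup, dif_pos hy]
        exact lookup_eq_override M u.2 y hy x.2 _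
      · obtain rfl : y = ⟨s, u.1⟩ := (List.mem_cons.1 h).resolve_right hy
        rw [NormalStructure.lookup, dif_neg hy, override_head _ _ _ hy]

/-- Evaluation in the term model is the value of the closed instances. -/
theorem eval_termModel (hv : IsHenkin v) : ∀ {γ : S.Srt} (e : Expr S γ) {σ : List S.VSrt}
    (u : S.VarSeq σ) (h : e.Persp u) (x : CTup v σ) {θ : (x : S.AnyVar) → HExpr S x.1},
    ClosedEnv θ →
    override (D := fun s : S.VSrt => Carrier v s) (valEnv v θ) u x = valEnv v θ →
    ((termModel hv).eval e u h).1 x = val v ((emb e).subst θ)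
  | _, .var y, _, u, h, x, θ, hθ, hx => by
      rw [emb, subst, NormalStructure.eval]
      exact (lookup_eq_override (termModel hv) u y _ x (valEnv v θ)).trans (congrFun hx y)
  | _, .app o vs args, σ, u, h, x, θ, hθ, hx => by
      rw [emb, NormalStructure.eval, ← (closed_subst (app o _ _) hθ).subst_eq θ, subst]
      refine termInterp_eq hv (fun i => ⟨(vs i).2, fun η hη => ?_⟩) hθ
      have hp : ClosedEnv (patch (tlist (vs i).1) η θ) := .patch (fun y _ => hη y) hθ
      rw [subst_mask_subst _ _ hθ]
      refine eval_termModel hv (args i) (tappend u (vs i).1) (h.arg i) _ hp (funext fun y => ?_)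
      refine (congrFun (override_tappend (D := fun s : S.VSrt => Carrier v s) _ u (vs i).1 x
        (tmapv (valEnv v η) (vs i).1)) y).trans ?_
      by_cases hy : y ∈ tlist (vs i).1
      · rw [override_tmapv_self _ _ _ hy, valEnv, valEnv, patch_of_mem hy]
      · rw [override_of_notMem _ _ _ hy, valEnv, patch_of_notMem hy,
          override_congr u x (g' := valEnv v θ) fun _ => ?_]
        · exact congrFun hx y
        · rw [valEnv, valEnv, patch_of_notMem hy]

theorem satisfies_termModel (hv : IsHenkin v) {φ : Formula S} (h : ∀ l, v (allList l (emb φ))) :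
    (termModel hv).Satisfies φ := by
  intro σ u hu x
  obtain ⟨θ, hθ, hx⟩ := exists_closedEnv (v := v) u x
  rw [eval_termModel hv φ u hu x hθ hx]
  exact (val_eq_verum_iff hv (closed_subst _ hθ)).2 (hv.subst_of_allList h hθ)

end Model
end FnlLogic

theorem mainTheorem2 (S : FnlLogic.Signature.{u}) (T : Set (FnlLogic.Formula S))
    (hT : FnlLogic.Consistent T) :
    ∃ M : FnlLogic.NormalStructure S, M.Models T := by
  obtain ⟨v, hv, h⟩ := FnlLogic.exists_isHenkin hT
  exact ⟨FnlLogic.termModel hv, fun φ hφ => FnlLogic.satisfies_termModel hv (h φ hφ)⟩
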